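/- All germs are germs at the origin of holomorphic maps, $\mathcal O_n=\mathbb C\{x_1,\dots,x_n\}$ denotes the ring of convergent power series and $\mathcal M_n$ its maximal ideal. The delta invariant of a map germ $g:(\mathbb C^n,0)\to(\mathbb C^p,0)$ is $\delta_g=\dim_{\mathbb C}\mathcal O_n/g^*(\mathcal O_p)$. Write $\underline x=(x_1,\dots,x_{n-1})$, $n\ge 1$. For a germ $f:(\mathbb C^n,0)\to(\mathbb C^{2n},0)$ of the form $f(\underline x,y)=(\underline x,f_n(\underline x,y),\dots,f_{2n}(\underline x,y))$ the double point number is $$d(f)=\frac12\dim_{\mathbb C}\frac{\mathcal O_{n+1}}{\langle\varphi_n,\dots,\varphi_{2n}\rangle},\qquad \varphi_i(\underline x,y,z)=\frac{f_i(\underline x,z)-f_i(\underline x,y)}{z-y}\in\mathcal O_{n+1}=\mathbb C\{\underline x,y,z\}.$$ Proposition. Let $\phi_2(y)=(y^{m_1},y^{m_2})$ with $1<m_1<m_2$ and $\gcd(m_1,m_2)=1$. Then $\delta_{\phi_2}$ is finite, and the following hold. 1. For $i=1,2$ let $h_i(\underline x,y)=y^{m_i}+\sum_{j>m_i}a_{ij}(\underline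 x)y^j\in\mathcal O_n$ with all $a_{ij}\in\mathcal M_{n-1}$. If $f(\underline x,y)=(\underline x,\ x_1y,\dots,x_{n-1}y,\ h_1(\underline x,y),\ h_2(\underline x,y))$, then $d(f)$ is finite and $$d(f)=\frac{(m_1-1)(m_2-1)}2=\delta_{\phi_2}.$$ 2. Let $\lambda_1,\dots,\lambda_{n-1}\ge 1$ be integers. If $f(\underline x,y)=(\underline x,\ y^{m_1},\ y^{m_2},\ x_1^{\lambda_1}y,\dots,x_{n-1}^{\lambda_{n-1}}y)$, then $d(f)$ is finite and $$d(f)=\Big(\prod_{i=1}^{n-1}\lambda_i\Big)\,\delta_{\phi_2}.$$ -/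

import Mathlib

noncomputable section

namespace JoinGerms

/-- A power series over `ℂ` converges near the origin if it converges absolutely at some
point `(r, …, r)` with `r > 0`. -/
def IsConvergent {σ : Type*} (f : MvPowerSeries σ ℂ) : Prop :=
  ∃ r : ℝ, 0 < r ∧ Summable fun α : σ →₀ ℕ => ‖MvPowerSeries.coeff α f‖ * r ^ α.degree

theorem IsConvergent.exists_bound {σ : Type*} {f : MvPowerSeries σ ℂ} (hf : IsConvergent f) :
    ∃ C R : ℝ, 0 < R ∧ ∀ α : σ →₀ ℕ, ‖MvPowerSeries.coeff α f‖ ≤ C * R ^ α.degree := by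
  obtain ⟨r, hr, hs⟩ := hf
  refine ⟨∑' α : σ →₀ ℕ, ‖MvPowerSeries.coeff α f‖ * r ^ α.degree, r⁻¹, by positivity,
    fun α => ?_⟩
  have h := hs.le_tsum α (fun β _ => by positivity)
  rw [inv_pow, ← div_eq_mul_inv, le_div_iff₀ (by positivity)]
  exact h

theorem summable_pow_degree {σ : Type*} [Finite σ] {q : ℝ} (h0 : 0 ≤ q) (h1 : q < 1) :
    Summable fun α : σ →₀ ℕ => q ^ α.degree := by
  classical
  have := Fintype.ofFinite σ
  refine summable_of_sum_le (c := ∏ _i : σ, ∑' j : ℕ, q ^ j) (fun α => by positivity) fun S => ?_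
  let N := S.sup Finsupp.degree + 1
  have hsub : ∑ α ∈ S, q ^ α.degree ≤
      ∑ g ∈ Fintype.piFinset (fun _ : σ => Finset.range N), ∏ i, q ^ g i := by
    rw [← Finset.sum_image (s := S) (g := fun α : σ →₀ ℕ => (α : σ → ℕ))
      (f := fun g : σ → ℕ => ∏ i, q ^ g i) (by intro a _ b _ h; exact DFunLike.coe_injective h)
      |>.trans (Finset.sum_congr rfl fun α _ => by
        rw [Finset.prod_pow_eq_pow_sum, Finsupp.degree_eq_sum])]
    refine Finset.sum_le_sum_of_subset_of_nonneg ?_ fun g _ _ => by positivity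
    intro g hg
    obtain ⟨α, hα, rfl⟩ := Finset.mem_image.1 hg
    rw [Fintype.mem_piFinset]
    intro i
    rw [Finset.mem_range]
    have h1 : α i ≤ α.degree := Finsupp.le_degree i α
    have h2 : α.degree ≤ S.sup Finsupp.degree := Finset.le_sup hα
    omega
  refine hsub.trans ?_
  rw [← Finset.prod_univ_sum]
  refine Finset.prod_le_prod (fun i _ => Finset.sum_nonneg fun j _ => by positivity) fun i _ => ?_
  exact (summable_geometric_of_lt_one h0 h1).sum_le_tsum _ (fun j _ => by positivity)

theorem isConvergent_of_bound {σ : Type*} [Finite σ] {f : MvPowerSeries σ ℂ} {C R : ℝ}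
    (hR : 0 < R) (h : ∀ α : σ →₀ ℕ, ‖MvPowerSeries.coeff α f‖ ≤ C * R ^ α.degree) :
    IsConvergent f := by
  refine ⟨(2 * R)⁻¹, by positivity, ?_⟩
  refine Summable.of_nonneg_of_le (fun α => by positivity) (fun α => ?_)
    ((summable_pow_degree (σ := σ) (q := 1 / 2) (by norm_num) (by norm_num)).mul_left C)
  calc ‖MvPowerSeries.coeff α f‖ * (2 * R)⁻¹ ^ α.degree
      ≤ C * R ^ α.degree * (2 * R)⁻¹ ^ α.degree := by gcongr; exact h α
    _ = C * (1 / 2) ^ α.degree := by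
      rw [mul_assoc, ← mul_pow]; congr 2; field_simp

theorem IsConvergent.mono_radius {σ : Type*} {f : MvPowerSeries σ ℂ} {r s : ℝ} (hs : 0 < s)
    (hsr : s ≤ r) (h : Summable fun α : σ →₀ ℕ => ‖MvPowerSeries.coeff α f‖ * r ^ α.degree) :
    Summable fun α : σ →₀ ℕ => ‖MvPowerSeries.coeff α f‖ * s ^ α.degree :=
  h.of_nonneg_of_le (fun α => by positivity) fun α => by gcongr

theorem IsConvergent.add {σ : Type*} {f g : MvPowerSeries σ ℂ} (hf : IsConvergent f)
    (hg : IsConvergent g) : IsConvergent (f + g) := by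
  obtain ⟨r, hr, hfs⟩ := hf
  obtain ⟨s, hs, hgs⟩ := hg
  have ht : 0 < min r s := lt_min hr hs
  refine ⟨min r s, ht, ((mono_radius ht (min_le_left _ _) hfs).add
    (mono_radius ht (min_le_right _ _) hgs)).of_nonneg_of_le (fun α => by positivity) fun α => ?_⟩
  rw [map_add, ← add_mul]
  gcongr
  exact norm_add_le _ _

theorem IsConvergent.mul {σ : Type*} {f g : MvPowerSeries σ ℂ} (hf : IsConvergent f)
    (hg : IsConvergent g) : IsConvergent (f * g) := by
  classical
  obtain ⟨r, hr, hfs⟩ := hf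
  obtain ⟨s, hs, hgs⟩ := hg
  have ht : 0 < min r s := lt_min hr hs
  generalize hF : (fun α : σ →₀ ℕ => ‖MvPowerSeries.coeff α f‖ * min r s ^ α.degree) = F
  generalize hG : (fun α : σ →₀ ℕ => ‖MvPowerSeries.coeff α g‖ * min r s ^ α.degree) = G
  have hF1 : Summable F := hF ▸ mono_radius ht (min_le_left _ _) hfs
  have hG1 : Summable G := hG ▸ mono_radius ht (min_le_right _ _) hgs
  have hF0 : 0 ≤ F := fun α => by rw [← hF]; positivity
  have hG0 : 0 ≤ G := fun α => by rw [← hG]; positivity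
  have hp := summable_sum_mul_antidiagonal_of_summable_mul (hF1.mul_of_nonneg hG1 hF0 hG0)
  refine ⟨min r s, ht, hp.of_nonneg_of_le (fun α => by positivity) fun α => ?_⟩
  rw [MvPowerSeries.coeff_mul]
  refine (mul_le_mul_of_nonneg_right (norm_sum_le _ _) (by positivity)).trans ?_
  rw [Finset.sum_mul]
  refine Finset.sum_le_sum fun p hp => ?_
  rw [← Finset.HasAntidiagonal.mem_antidiagonal.1 hp, map_add, pow_add, norm_mul, ← hF, ← hG]
  exact le_of_eq (by ring)

theorem IsConvergent.monomial {σ : Type*} (β : σ →₀ ℕ) (c : ℂ) :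
    IsConvergent (MvPowerSeries.monomial β c) := by
  classical
  refine ⟨1, one_pos, summable_of_ne_finset_zero (s := {β}) fun α hα => ?_⟩
  rw [MvPowerSeries.coeff_monomial, if_neg (by simpa using hα)]
  simp

/-- The ring `ℂ{σ}` of convergent power series in the variables `σ`, i.e. the local ring
`𝒪ₙ` of germs at the origin of holomorphic functions on `ℂⁿ` when `σ` has `n` elements. -/
def Conv (σ : Type*) : Subalgebra ℂ (MvPowerSeries σ ℂ) where
  carrier := {f | IsConvergent f}
  mul_mem' := IsConvergent.mul
  add_mem' := IsConvergent.add
  algebraMap_mem' c := IsConvergent.monomial 0 c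

theorem mem_conv {σ : Type*} {f : MvPowerSeries σ ℂ} : f ∈ Conv σ ↔ IsConvergent f := Iff.rfl

theorem X_mem_conv {σ : Type*} (i : σ) : (MvPowerSeries.X i : MvPowerSeries σ ℂ) ∈ Conv σ := by
  rw [mem_conv, MvPowerSeries.X]
  exact IsConvergent.monomial _ _

/-- The coordinate function `X i`. -/
def Conv.X {σ : Type*} (i : σ) : Conv σ :=
  ⟨MvPowerSeries.X i, X_mem_conv i⟩

/-- A holomorphic map germ `(ℂ^σ, 0) → (ℂ^τ, 0)`. -/
structure MapGerm (σ τ : Type*) where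
  /-- The components of the germ. -/
  comp : τ → Conv σ
  /-- The origin is mapped to the origin. -/
  map_zero : ∀ t, MvPowerSeries.constantCoeff (comp t : MvPowerSeries σ ℂ) = 0

theorem MapGerm.hasSubst {σ τ : Type*} [Finite τ] (f : MapGerm σ τ) :
    MvPowerSeries.HasSubst fun t => (f.comp t : MvPowerSeries σ ℂ) :=
  MvPowerSeries.hasSubst_of_constantCoeff_zero f.map_zero

/-- `f^*(𝒪_p) ⊆ 𝒪_n`: the germs of the form `v ∘ f` with `v ∈ 𝒪_p`. -/
def MapGerm.pullback {σ τ : Type*} [Finite τ] (f : MapGerm σ τ) : Submodule ℂ (Conv σ) :=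
  ((Subalgebra.toSubmodule (Conv τ)).map
    (MvPowerSeries.substAlgHom (R := ℂ) f.hasSubst).toLinearMap).comap (Conv σ).val.toLinearMap

/-- The delta invariant `δ_f = dim_ℂ 𝒪_n / f^*(𝒪_p)`. (`Module.finrank` is `0` for an
infinite-dimensional quotient, so finite-dimensionality is to be stated separately.) -/
def MapGerm.delta {σ τ : Type*} [Finite τ] (f : MapGerm σ τ) : ℕ :=
  Module.finrank ℂ (Conv σ ⧸ f.pullback)

/-- For an exponent `m` of the variables `(x, y, z)`, where `y` and `z` are `Sum.inr 0` and
`Sum.inr 1`, the exponent of `(x, y)` with the same `x`-part and with `y`-part `m_y + m_z + 1`. -/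
def mergeExponent {k : ℕ} (m : Fin k ⊕ Fin 2 →₀ ℕ) : Fin k ⊕ Fin 1 →₀ ℕ :=
  Finsupp.equivFunOnFinite.symm
    (Sum.elim (fun i => m (Sum.inl i)) fun _ => m (Sum.inr 0) + m (Sum.inr 1) + 1)

theorem degree_mergeExponent {k : ℕ} (m : Fin k ⊕ Fin 2 →₀ ℕ) :
    (mergeExponent m).degree = m.degree + 1 := by
  simp [Finsupp.degree_eq_sum, mergeExponent, Fin.sum_univ_two]
  omega

/-- The divided difference `(g(x, z) - g(x, y)) / (z - y)` as a power series in `(x, y, z)`: it sends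
`x^α y^(j+1)` to `x^α ∑_{a+b=j} y^a z^b`. -/
def dividedDifferenceSeries {k : ℕ} (g : MvPowerSeries (Fin k ⊕ Fin 1) ℂ) :
    MvPowerSeries (Fin k ⊕ Fin 2) ℂ :=
  fun m => MvPowerSeries.coeff (mergeExponent m) g

theorem coeff_dividedDifferenceSeries {k : ℕ} (g : MvPowerSeries (Fin k ⊕ Fin 1) ℂ)
    (m : Fin k ⊕ Fin 2 →₀ ℕ) : MvPowerSeries.coeff m (dividedDifferenceSeries g) =
      MvPowerSeries.coeff (mergeExponent m) g := rfl

theorem IsConvergent.dividedDifferenceSeries {k : ℕ} {g : MvPowerSeries (Fin k ⊕ Fin 1) ℂ}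
    (hg : IsConvergent g) : IsConvergent (dividedDifferenceSeries g) := by
  obtain ⟨C, R, hR, h⟩ := hg.exists_bound
  refine isConvergent_of_bound (C := C * R) hR fun m => ?_
  rw [coeff_dividedDifferenceSeries]
  refine (h _).trans (le_of_eq ?_)
  rw [degree_mergeExponent]
  ring

/-- The divided difference `(g(x, z) - g(x, y)) / (z - y)` of a germ `g(x, y)`, as a germ in
`(x, y, z)`, with `y` and `z` the variables `Sum.inr 0` and `Sum.inr 1`. -/
def dividedDifference {k : ℕ} (g : Conv (Fin k ⊕ Fin 1)) : Conv (Fin k ⊕ Fin 2) :=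
  ⟨dividedDifferenceSeries g,
    mem_conv.2 (IsConvergent.dividedDifferenceSeries (mem_conv.1 g.2))⟩

/-- The substitution of the variables `(x, y)` by `(x, y)` for `j = 0` and by `(x, z)` for `j = 1`. -/
def varMap (k : ℕ) (j : Fin 2) : Fin k ⊕ Fin 1 ↪ Fin k ⊕ Fin 2 :=
  ⟨Sum.map id fun _ => j, Function.injective_id.sumMap (Function.injective_of_subsingleton _)⟩

theorem coeff_rename_varMap {k : ℕ} (g : MvPowerSeries (Fin k ⊕ Fin 1) ℂ) (j : Fin 2)
    (m : Fin k ⊕ Fin 2 →₀ ℕ) :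
    MvPowerSeries.coeff m (MvPowerSeries.rename (varMap k j) g) =
      if m (Sum.inr (1 - j)) = 0 then MvPowerSeries.coeff (m.comapDomain (varMap k j)
        (varMap k j).injective.injOn) g else 0 := by
  classical
  split_ifs with h
  · have hm : m = (m.comapDomain (varMap k j) (varMap k j).injective.injOn).embDomain
        (varMap k j) := by
      symm
      rw [Finsupp.embDomain_eq_mapDomain]
      refine Finsupp.mapDomain_comapDomain _ (varMap k j).injective _ ?_
      intro v hv
      rcases v with i | i
      · exact ⟨Sum.inl i, rfl⟩
      · refine ⟨Sum.inr 0, ?_⟩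
        by_cases hij : i = j
        · subst hij; rfl
        · exfalso
          have : i = 1 - j := by fin_cases i <;> fin_cases j <;> simp_all
          rw [this] at hv
          simp [h] at hv
    conv_lhs => rw [hm]
    exact MvPowerSeries.coeff_embDomain_rename _ _ _
  · apply MvPowerSeries.coeff_rename_eq_zero
    rintro ⟨α, hα⟩
    apply h
    rw [← hα]
    apply Finsupp.mapDomain_of_notMem_range
    rintro ⟨v, hv⟩
    rcases v with i | i
    · simp [varMap] at hv
    · simp [varMap] at hv
      fin_cases j <;> simp at hv

/-- The divided difference is the quotient of `g(x, z) - g(x, y)` by `z - y`. -/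
theorem sub_mul_dividedDifference {k : ℕ} (g : Conv (Fin k ⊕ Fin 1)) :
    (MvPowerSeries.X (Sum.inr 1) - MvPowerSeries.X (Sum.inr 0)) *
        (dividedDifference g : MvPowerSeries (Fin k ⊕ Fin 2) ℂ) =
      MvPowerSeries.rename (varMap k 1) (g : MvPowerSeries (Fin k ⊕ Fin 1) ℂ) -
        MvPowerSeries.rename (varMap k 0) (g : MvPowerSeries (Fin k ⊕ Fin 1) ℂ) := by
  classical
  ext m
  rw [sub_mul, map_sub, map_sub, coeff_rename_varMap, coeff_rename_varMap]
  simp only [MvPowerSeries.X, MvPowerSeries.coeff_monomial_mul, one_mul, Finsupp.single_le_iff,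
    dividedDifference, coeff_dividedDifferenceSeries]
  have e1 : 1 ≤ m (Sum.inr 1) → mergeExponent (m - Finsupp.single (Sum.inr 1) 1) =
      Finsupp.equivFunOnFinite.symm
        (Sum.elim (fun i => m (Sum.inl i)) fun _ => m (Sum.inr 0) + m (Sum.inr 1)) := by
    intro h
    ext v
    rcases v with i | i <;> simp [mergeExponent]
    omega
  have e0 : 1 ≤ m (Sum.inr 0) → mergeExponent (m - Finsupp.single (Sum.inr 0) 1) =
      Finsupp.equivFunOnFinite.symm
        (Sum.elim (fun i => m (Sum.inl i)) fun _ => m (Sum.inr 0) + m (Sum.inr 1)) := by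
    intro h
    ext v
    rcases v with i | i <;> simp [mergeExponent]
    omega
  have c1 : m (Sum.inr 0) = 0 → m.comapDomain (varMap k 1) (varMap k 1).injective.injOn =
      Finsupp.equivFunOnFinite.symm
        (Sum.elim (fun i => m (Sum.inl i)) fun _ => m (Sum.inr 0) + m (Sum.inr 1)) := by
    intro h
    ext v
    rcases v with i | i <;> simp [varMap, h]
  have c0 : m (Sum.inr 1) = 0 → m.comapDomain (varMap k 0) (varMap k 0).injective.injOn =
      Finsupp.equivFunOnFinite.symm
        (Sum.elim (fun i => m (Sum.inl i)) fun _ => m (Sum.inr 0) + m (Sum.inr 1)) := by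
    intro h
    ext v
    rcases v with i | i <;> simp [varMap, h]
  by_cases h0 : m (Sum.inr 0) = 0 <;> by_cases h1 : m (Sum.inr 1) = 0
  · simp [h0, h1, c0 h1, c1 h0]
  · simp [h0, h1, c1 h0, e1 (Nat.one_le_iff_ne_zero.2 h1), Nat.one_le_iff_ne_zero]
  · simp [h0, h1, c0 h1, e0 (Nat.one_le_iff_ne_zero.2 h0), Nat.one_le_iff_ne_zero]
  · simp [h0, h1, e1 (Nat.one_le_iff_ne_zero.2 h1), e0 (Nat.one_le_iff_ne_zero.2 h0),
      Nat.one_le_iff_ne_zero]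

/-- With `n = k + 1`, the germ `f : (ℂⁿ, 0) → (ℂ²ⁿ, 0)` is written in the normal form
`f(x, y) = (x, fₙ(x, y), …, f₂ₙ(x, y))` of germs of corank at most one, where `x = (x₁, …, xₙ₋₁)`. -/
def MapGerm.IsCorankOneForm {k : ℕ} (f : MapGerm (Fin k ⊕ Fin 1) (Fin k ⊕ Fin (k + 2))) : Prop :=
  ∀ i : Fin k, f.comp (Sum.inl i) = Conv.X (Sum.inl i)

/-- The ideal of `𝒪ₙ₊₁ = ℂ{x, y, z}` generated by the divided differences
`φ_i = (f_i(x, z) - f_i(x, y)) / (z - y)`, `n ≤ i ≤ 2n`, of a germ `f = (x, fₙ, …, f₂ₙ)`. -/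
def MapGerm.doublePointIdeal {k : ℕ} (f : MapGerm (Fin k ⊕ Fin 1) (Fin k ⊕ Fin (k + 2))) :
    Ideal (Conv (Fin k ⊕ Fin 2)) :=
  Ideal.span (Set.range fun i : Fin (k + 2) => dividedDifference (f.comp (Sum.inr i)))

/-- The double point number `d(f) = (1/2) dim_ℂ 𝒪ₙ₊₁ / (φₙ, …, φ₂ₙ)` of a germ
`f(x, y) = (x, fₙ(x, y), …, f₂ₙ(x, y))`. (`Module.finrank` is `0` for an infinite-dimensional
quotient, so finite-dimensionality is to be stated separately.) -/
def MapGerm.doublePointNumber {k : ℕ} (f : MapGerm (Fin k ⊕ Fin 1) (Fin k ⊕ Fin (k + 2))) : ℚ :=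
  (Module.finrank ℂ (Conv (Fin k ⊕ Fin 2) ⧸ f.doublePointIdeal) : ℚ) / 2

/-- `h(x, y) = y^m + ∑_{j > m} a_j(x) y^j` with all `a_j` in the maximal ideal of `ℂ{x}`; this is
said coefficientwise: the coefficient of `x^α y^j` in `h - y^m` is that of `x^α` in `a_j` for
`j > m`, and is zero for `j ≤ m`. -/
def IsDeformationOfPower {k : ℕ} (m : ℕ) (h : Conv (Fin k ⊕ Fin 1)) : Prop :=
  ∃ a : ℕ → Conv (Fin k),
    (∀ j, MvPowerSeries.constantCoeff (a j : MvPowerSeries (Fin k) ℂ) = 0) ∧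
    ∀ (α : Fin k →₀ ℕ) (j : ℕ),
      MvPowerSeries.coeff (Finsupp.sumElim α (Finsupp.single 0 j))
          ((h - Conv.X (Sum.inr 0) ^ m : Conv (Fin k ⊕ Fin 1)) :
            MvPowerSeries (Fin k ⊕ Fin 1) ℂ) =
        if m < j then MvPowerSeries.coeff α (a j : MvPowerSeries (Fin k) ℂ) else 0

end JoinGerms

end

noncomputable section

namespace JoinGerms

/-! Write P_m = (z^m - y^m)/(z - y), a = m₁ and b = m₂. The divided difference of x_i^λ y is x_i^λ.
Hence in both parts the double point ideal is generated by powers x_i^(n_i) together with P_a and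
P_b. In part 1 all n_i = 1, and the terms a_ij(x) y^j disappear because their divided differences
already lie in (x₁, …, x_k). The monomials x^α with α < n then split the quotient into ∏ n_i copies
of ℂ{y, z}/(P_a, P_b) (`boxQuotientEquiv`).

That plane quotient has dimension (a - 1)(b - 1). P_a is the product of the a - 1 lines z - ζy with
ζ^a = 1, ζ ≠ 1. On each of them P_b restricts to c y^(b-1), where c ≠ 0 because a and b are coprime.
So each line contributes b - 1, and contributions add up (`finrank_quotient_span_mul`,
`finrank_quotient_powDiff`).

The pullback of 𝒪₂ under (y^a, y^b) consists of the germs supported on the semigroup generated by a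
and b, so δ is its number of gaps. The reflection s ↦ ab - a - b - s exchanges gaps and non-gaps,
giving 2δ = (a - 1)(b - 1) (`delta_monomialCurve`).

All germs are convergent, so every quotient or preimage defined by a coefficient formula needs a
geometric bound on its coefficients. -/

open MvPowerSeries Finsupp

/-! ### Additivity of colength -/

/-- A ring modulo `(f * L, Q)` has the dimension of the rings modulo `(f, Q)` and `(L, Q)`
together when `L` is a nonzerodivisor modulo `Q`. -/
theorem finrank_quotient_span_mul {R : Type*} [CommRing R] [Algebra ℂ R] (f L Q : R)
    (h : ∀ u v, L * u = Q * v → ∃ w, u = Q * w)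
    [Module.Finite ℂ (R ⧸ Ideal.span {f, Q})] [Module.Finite ℂ (R ⧸ Ideal.span {L, Q})] :
    Module.Finite ℂ (R ⧸ Ideal.span {f * L, Q}) ∧
      Module.finrank ℂ (R ⧸ Ideal.span {f * L, Q}) =
        Module.finrank ℂ (R ⧸ Ideal.span {f, Q}) + Module.finrank ℂ (R ⧸ Ideal.span {L, Q}) := by
  let N := Ideal.span {f * L, Q}
  let M := Ideal.span {L, Q}
  have hNM : N ≤ M := by
    rw [Ideal.span_le]
    rintro x (rfl | rfl)
    · exact Ideal.mul_mem_left _ _ (Ideal.subset_span (by simp))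
    · exact Ideal.subset_span (by simp)
  let π : (R ⧸ N) →ₗ[ℂ] (R ⧸ M) := (Ideal.Quotient.factorₐ ℂ hNM).toLinearMap
  have hπ : Function.Surjective π := Ideal.Quotient.factor_surjective hNM
  -- Multiplication by L yields the exact sequence 0 → R/(f, Q) → R/(fL, Q) → R/(L, Q) → 0. The
  -- hypothesis `h` is what makes its first map injective.
  let ψ : R →ₗ[ℂ] (R ⧸ N) := (Ideal.Quotient.mkₐ ℂ N).toLinearMap.comp (LinearMap.mulLeft ℂ L)
  have hψker : LinearMap.ker ψ = (Ideal.span {f, Q}).restrictScalars ℂ := by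
    ext u
    rw [LinearMap.mem_ker, Submodule.restrictScalars_mem]
    change Ideal.Quotient.mk N (L * u) = 0 ↔ _
    rw [Ideal.Quotient.eq_zero_iff_mem]
    constructor
    · intro hu
      obtain ⟨a, b, hab⟩ := Ideal.mem_span_pair.1 hu
      obtain ⟨w, hw⟩ := h (u - a * f) b (by linear_combination -hab)
      exact Ideal.mem_span_pair.2 ⟨a, w, by linear_combination -hw⟩
    · intro hu
      obtain ⟨a, b, rfl⟩ := Ideal.mem_span_pair.1 hu
      exact Ideal.mem_span_pair.2 ⟨a, b * L, by ring⟩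
  have hψrange : LinearMap.range ψ = LinearMap.ker π := by
    ext x
    obtain ⟨x, rfl⟩ := Ideal.Quotient.mk_surjective x
    rw [LinearMap.mem_range, LinearMap.mem_ker]
    change (∃ y, Ideal.Quotient.mk N (L * y) = _) ↔ Ideal.Quotient.mk M x = 0
    rw [Ideal.Quotient.eq_zero_iff_mem]
    constructor
    · rintro ⟨y, hy⟩
      have h1 := hNM (Ideal.Quotient.eq.1 hy)
      have h2 : L * y ∈ M := Ideal.mul_mem_right _ _ (Ideal.subset_span (by simp))
      have := sub_mem h2 h1
      simpa using this
    · intro hx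
      obtain ⟨a, b, rfl⟩ := Ideal.mem_span_pair.1 hx
      refine ⟨a, Ideal.Quotient.eq.2 (Ideal.mem_span_pair.2 ⟨0, -b, by ring⟩)⟩
  let e : (R ⧸ Ideal.span {f, Q}) ≃ₗ[ℂ] LinearMap.ker π :=
    (Submodule.Quotient.restrictScalarsEquiv ℂ _).symm ≪≫ₗ
      Submodule.quotEquivOfEq _ _ hψker.symm ≪≫ₗ ψ.quotKerEquivRange ≪≫ₗ
        LinearEquiv.ofEq _ _ hψrange
  let e' : ((R ⧸ N) ⧸ LinearMap.ker π) ≃ₗ[ℂ] (R ⧸ M) := π.quotKerEquivOfSurjective hπ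
  have : Module.Finite ℂ (LinearMap.ker π) := Module.Finite.equiv e
  have : Module.Finite ℂ ((R ⧸ N) ⧸ LinearMap.ker π) := Module.Finite.equiv e'.symm
  have hfin : Module.Finite ℂ (R ⧸ N) := Module.Finite.of_submodule_quotient (LinearMap.ker π)
  refine ⟨hfin, ?_⟩
  rw [e.finrank_eq, ← e'.finrank_eq, add_comm]
  exact (Submodule.finrank_quotient_add_finrank _).symm

/-! ### Gaps of a numerical semigroup with two generators -/

/-- An integer is a combination of `a` and `b` with natural coefficients. -/
def IsRepresentable (a b : ℕ) (s : ℤ) : Prop :=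
  ∃ i j : ℕ, s = i * a + j * b

/-- If both numbers were representable, adding them would write ab as a positive multiple of a plus
a positive multiple of b. Then b divides the first coefficient, so the first term alone is at least
ab. Conversely, Bézout gives s = ra + tb with 0 ≤ r < b. If t < 0, the reflected number is (b - 1 -
r)a + (-1 - t)b. -/
theorem isRepresentable_iff_not {a b : ℕ} (ha : 0 < a) (hb : 0 < b) (h : Nat.gcd a b = 1)
    (s : ℤ) : IsRepresentable a b s ↔ ¬ IsRepresentable a b (a * b - a - b - s) := by
  have hb' : (0 : ℤ) < b := by exact_mod_cast hb
  have ha' : (0 : ℤ) < a := by exact_mod_cast ha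
  constructor
  · rintro ⟨i, j, rfl⟩ ⟨i', j', hs⟩
    have h1 : ((i : ℤ) + i' + 1) * a + (j + j' + 1) * b = a * b := by linear_combination -hs
    have h2 : (b : ℤ) ∣ ((i : ℤ) + i' + 1) * a :=
      ⟨a - (j + j' + 1), by linear_combination h1⟩
    have h3 : (b : ℤ) ∣ (i : ℤ) + i' + 1 :=
      IsCoprime.dvd_of_dvd_mul_right (by
        rw [Int.isCoprime_iff_gcd_eq_one, Int.gcd_natCast_natCast, Nat.gcd_comm]; exact h) h2
    have h4 := Int.le_of_dvd (by positivity) h3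
    have h5 : (0 : ℤ) < (j + j' + 1) * b := by positivity
    nlinarith [mul_le_mul_of_nonneg_right h4 ha'.le]
  · intro hn
    have hbez : (a : ℤ) * Nat.gcdA a b + b * Nat.gcdB a b = 1 := by
      rw [← Nat.gcd_eq_gcd_ab, h]; rfl
    generalize Nat.gcdA a b = u at hbez
    generalize Nat.gcdB a b = v at hbez
    have hr0 := Int.emod_nonneg (s * u) hb'.ne'
    have hr1 := Int.emod_lt_of_pos (s * u) hb'
    have hr2 := Int.emod_add_mul_ediv (s * u) b
    generalize (s * u) % b = r at *
    generalize (s * u) / b = q at *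
    have hs : s = r * a + (s * v + q * a) * b := by
      linear_combination (-s) * hbez - a * hr2
    generalize s * v + q * a = t at hs
    rcases le_or_gt 0 t with ht | ht
    · lift r to ℕ using hr0
      lift t to ℕ using ht
      exact ⟨r, t, hs⟩
    · exfalso
      obtain ⟨i, hi⟩ := Int.eq_ofNat_of_zero_le (show 0 ≤ b - 1 - r by omega)
      obtain ⟨j, hj⟩ := Int.eq_ofNat_of_zero_le (show 0 ≤ -1 - t by omega)
      exact hn ⟨i, j, by rw [← hi, ← hj]; linear_combination -hs⟩

open Classical in
/-- The gaps of the numerical semigroup generated by `a` and `b`. -/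
def gaps (a b : ℕ) : Finset ℕ :=
  (Finset.range ((a - 1) * (b - 1))).filter fun s : ℕ => ¬ IsRepresentable a b s

theorem cast_mul_pred {a b : ℕ} (ha : 0 < a) (hb : 0 < b) :
    (((a - 1) * (b - 1) : ℕ) : ℤ) = a * b - a - b + 1 := by
  rw [Nat.cast_mul, Nat.cast_sub ha, Nat.cast_sub hb]
  push_cast
  ring

/-- The cutoff in `gaps` loses nothing: the reflection of an s ≥ (a - 1)(b - 1) is negative, hence
not representable, so s is representable. -/
theorem mem_gaps {a b : ℕ} (ha : 0 < a) (hb : 0 < b) (h : Nat.gcd a b = 1) (s : ℕ) :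
    s ∈ gaps a b ↔ ¬ IsRepresentable a b s := by
  classical
  rw [gaps, Finset.mem_filter, and_iff_right_iff_imp, Finset.mem_range]
  intro hs
  by_contra hlt
  rw [isRepresentable_iff_not ha hb h, not_not] at hs
  obtain ⟨i, j, hij⟩ := hs
  have h0 : (0 : ℤ) ≤ i * a + j * b := by positivity
  have := cast_mul_pred ha hb
  omega

/-- The reflection s ↦ (a - 1)(b - 1) - 1 - s of the interval swaps gaps with representable numbers,
so the gaps are exactly half of it. -/
theorem two_mul_card_gaps {a b : ℕ} (ha : 0 < a) (hb : 0 < b) (h : Nat.gcd a b = 1) :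
    2 * (gaps a b).card = (a - 1) * (b - 1) := by
  classical
  have key := Finset.card_filter_add_card_filter_not (s := Finset.range ((a - 1) * (b - 1)))
    (fun s : ℕ => IsRepresentable a b s)
  rw [Finset.card_range] at key
  have heq : (gaps a b).card = ((Finset.range ((a - 1) * (b - 1))).filter
      fun s : ℕ => IsRepresentable a b s).card := by
    have hc := cast_mul_pred ha hb
    have hsub : ∀ s : ℕ, s < (a - 1) * (b - 1) →
        (((a - 1) * (b - 1) - 1 - s : ℕ) : ℤ) = a * b - a - b - s := fun s hs => by omega
    refine Finset.card_bij' (fun s _ => (a - 1) * (b - 1) - 1 - s)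
      (fun s _ => (a - 1) * (b - 1) - 1 - s) ?_ ?_ ?_ ?_
    · intro s hs
      rw [gaps, Finset.mem_filter, Finset.mem_range] at hs
      rw [Finset.mem_filter, Finset.mem_range, hsub s hs.1]
      refine ⟨by omega, ?_⟩
      by_contra hn
      exact hs.2 ((isRepresentable_iff_not ha hb h _).2 hn)
    · intro s hs
      rw [Finset.mem_filter, Finset.mem_range] at hs
      rw [gaps, Finset.mem_filter, Finset.mem_range, hsub s hs.1]
      exact ⟨by omega, (isRepresentable_iff_not ha hb h _).1 hs.2⟩
    · intro s hs
      rw [gaps, Finset.mem_filter, Finset.mem_range] at hs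
      omega
    · intro s hs
      rw [Finset.mem_filter, Finset.mem_range] at hs
      omega
  have : (gaps a b).card = ((Finset.range ((a - 1) * (b - 1))).filter
      fun s : ℕ => ¬ IsRepresentable a b s).card := by
    rw [gaps]
  omega

/-! ### Convergent germs: monomial ideals and slices -/

theorem Conv.ext_coeff {σ : Type*} {f g : Conv σ}
    (h : ∀ m, coeff m (f : MvPowerSeries σ ℂ) = coeff m (g : MvPowerSeries σ ℂ)) : f = g :=
  Subtype.ext (MvPowerSeries.ext h)

@[simp] theorem Conv.coe_X {σ : Type*} (i : σ) :
    ((Conv.X i : Conv σ) : MvPowerSeries σ ℂ) = MvPowerSeries.X i := rfl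

theorem Conv.coeff_X_pow_mul {σ : Type*} (i : σ) (n : ℕ) (g : Conv σ) (m : σ →₀ ℕ) :
    coeff m ((Conv.X i ^ n * g : Conv σ) : MvPowerSeries σ ℂ) =
      if n ≤ m i then coeff (m - single i n) (g : MvPowerSeries σ ℂ) else 0 := by
  classical
  simp [MvPowerSeries.X_pow_eq, coeff_monomial_mul]

/-- The bound on the coefficients of a convergent series may be taken with positive constants. -/
theorem IsConvergent.exists_bound_pos {σ : Type*} {f : MvPowerSeries σ ℂ} (hf : IsConvergent f) :
    ∃ C R : ℝ, 0 ≤ C ∧ 1 ≤ R ∧ ∀ α : σ →₀ ℕ, ‖coeff α f‖ ≤ C * R ^ α.degree := by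
  obtain ⟨C, R, hR, h⟩ := hf.exists_bound
  have hC : 0 ≤ C := by simpa using (norm_nonneg _).trans (h 0)
  refine ⟨C, max R 1, hC, le_max_right _ _, fun α => (h α).trans ?_⟩
  gcongr
  exact le_max_left _ _

/-- A germ all of whose monomials are divisible by one of the `X (v i) ^ n i` lies in the ideal
generated by these powers. -/
theorem mem_span_X_pow {σ ι : Type*} [Finite σ] [Fintype ι] (v : ι → σ) (n : ι → ℕ) (g : Conv σ)
    (h : ∀ m : σ →₀ ℕ, (∀ i, m (v i) < n i) → coeff m (g : MvPowerSeries σ ℂ) = 0) :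
    g ∈ Ideal.span (Set.range fun i => (Conv.X (v i) : Conv σ) ^ n i) := by
  classical
  -- Each monomial is charged to a single generator dividing it. The cofactor `G i` collects the
  -- monomials charged to i, shifted down; its coefficients are zero or coefficients of g, so it
  -- converges.
  let pick : (σ →₀ ℕ) → Option ι := fun m =>
    if h : ∃ i, n i ≤ m (v i) then some h.choose else none
  have hpick : ∀ m i, pick m = some i → n i ≤ m (v i) := by
    intro m i hi
    by_cases h : ∃ i, n i ≤ m (v i)
    · simp only [pick, dif_pos h, Option.some.injEq] at hi
      exact hi ▸ h.choose_spec
    · simp [pick, dif_neg h] at hi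
  let G : ι → MvPowerSeries σ ℂ := fun i m =>
    if pick (m + single (v i) (n i)) = some i then
      coeff (m + single (v i) (n i)) (g : MvPowerSeries σ ℂ) else 0
  have hG : ∀ i m, coeff m (G i) = if pick (m + single (v i) (n i)) = some i then
      coeff (m + single (v i) (n i)) (g : MvPowerSeries σ ℂ) else 0 := fun i m => rfl
  have hconv : ∀ i, G i ∈ Conv σ := by
    intro i
    obtain ⟨C, R, hC, hR, hb⟩ := (mem_conv.1 g.2).exists_bound_pos
    refine mem_conv.2 (isConvergent_of_bound (C := C * R ^ n i) (R := R) (by linarith) fun m => ?_)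
    rw [hG]
    split_ifs
    · refine (hb _).trans (le_of_eq ?_)
      rw [map_add, degree_single, pow_add]
      ring
    · simp only [norm_zero]; positivity
  have hsum : g = ∑ i, Conv.X (v i) ^ n i * (⟨G i, hconv i⟩ : Conv σ) := by
    refine Conv.ext_coeff fun m => ?_
    rw [AddSubmonoidClass.coe_finsetSum, map_sum]
    have hterm : ∀ i, coeff m ((Conv.X (v i) ^ n i * (⟨G i, hconv i⟩ : Conv σ) : Conv σ) :
        MvPowerSeries σ ℂ) = if pick m = some i then coeff m (g : MvPowerSeries σ ℂ) else 0 := by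
      intro i
      rw [Conv.coeff_X_pow_mul]
      by_cases hi : n i ≤ m (v i)
      · rw [if_pos hi, hG, tsub_add_cancel_of_le (single_le_iff.2 hi)]
      · rw [if_neg hi, if_neg fun hp => hi (hpick m i hp)]
    simp only [hterm]
    by_cases hm : ∃ i, n i ≤ m (v i)
    · obtain ⟨i, hi⟩ : ∃ i, pick m = some i := ⟨_, dif_pos hm⟩
      simp [hi]
    · rw [h m (by simpa using hm)]
      simp
  rw [hsum]
  exact Ideal.sum_mem _ fun i _ => Ideal.mul_mem_right _ _ (Ideal.subset_span ⟨i, rfl⟩)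

theorem degree_sumElim {σ τ : Type*} (α : σ →₀ ℕ) (m : τ →₀ ℕ) :
    (sumElim α m).degree = α.degree + m.degree := by
  rw [sumElim_eq_add, map_add, degree_mapDomain, degree_mapDomain]

/-- The coefficient of `x^α` of a germ `g(x, y)`, as a germ in `y`. -/
def slice {σ τ : Type*} [Finite τ] (α : σ →₀ ℕ) : Conv (σ ⊕ τ) →ₗ[ℂ] Conv τ where
  toFun g := ⟨fun m => coeff (sumElim α m) (g : MvPowerSeries (σ ⊕ τ) ℂ), by
    obtain ⟨C, R, hC, hR, hb⟩ := (mem_conv.1 g.2).exists_bound_pos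
    refine mem_conv.2 (isConvergent_of_bound (C := C * R ^ α.degree) (R := R) (by linarith)
      fun m => (hb (sumElim α m)).trans (le_of_eq ?_))
    rw [degree_sumElim, pow_add, mul_assoc]⟩
  map_add' f g := rfl
  map_smul' c f := rfl

theorem coeff_slice {σ τ : Type*} [Finite τ] (α : σ →₀ ℕ) (g : Conv (σ ⊕ τ)) (m : τ →₀ ℕ) :
    coeff m (slice α g : MvPowerSeries τ ℂ) =
      coeff (sumElim α m) (g : MvPowerSeries (σ ⊕ τ) ℂ) := rfl

theorem coeff_rename_inr {σ τ : Type*} [DecidableEq σ] (u : MvPowerSeries τ ℂ) (α : σ →₀ ℕ)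
    (m : τ →₀ ℕ) :
    coeff (sumElim α m) (rename (Function.Embedding.inr : τ ↪ σ ⊕ τ) u) =
      if α = 0 then coeff m u else 0 := by
  split_ifs with h
  · subst h
    rw [← embDomain_inr]
    exact coeff_embDomain_rename _ _ _
  · apply coeff_rename_eq_zero
    rintro ⟨β, hβ⟩
    apply h
    ext i
    rw [← sumElim_inl α m i, ← hβ]
    apply mapDomain_of_notMem_range
    rintro ⟨j, hj⟩
    cases hj

theorem sumElim_fst_snd {σ τ : Type*} (m : σ ⊕ τ →₀ ℕ) :
    ∃ (α : σ →₀ ℕ) (β : τ →₀ ℕ), m = sumElim α β :=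
  ⟨_, _, (comapDomain_sumElim_comapDomain m).symm⟩

/-- A germ in `y` regarded as a germ in `(x, y)`. -/
def incl (σ τ : Type*) [Finite σ] [Finite τ] : Conv τ →ₐ[ℂ] Conv (σ ⊕ τ) :=
  ((rename (R := ℂ) (Function.Embedding.inr : τ ↪ σ ⊕ τ)).comp (Conv τ).val).codRestrict _ <| by
    classical
    intro u
    obtain ⟨C, R, hC, hR, hb⟩ := (mem_conv.1 u.2).exists_bound_pos
    refine mem_conv.2 (isConvergent_of_bound (C := C) (R := R) (by linarith) fun m => ?_)
    obtain ⟨α, β, rfl⟩ := sumElim_fst_snd m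
    simp only [AlgHom.coe_comp, Function.comp_apply, Subalgebra.coe_val, coeff_rename_inr]
    split_ifs with h
    · simpa [h, degree_sumElim] using hb β
    · simp only [norm_zero]; positivity

theorem coeff_incl {σ τ : Type*} [Finite σ] [Finite τ] [DecidableEq σ] (u : Conv τ) (α : σ →₀ ℕ)
    (m : τ →₀ ℕ) : coeff (sumElim α m) (incl σ τ u : MvPowerSeries (σ ⊕ τ) ℂ) =
      if α = 0 then coeff m (u : MvPowerSeries τ ℂ) else 0 :=
  coeff_rename_inr _ _ _

theorem incl_X {σ τ : Type*} [Finite σ] [Finite τ] (i : τ) :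
    incl σ τ (Conv.X i) = Conv.X (Sum.inr i) :=
  Subtype.ext (rename_X _ i)

/-- A germ in the second variables alone has only the x-exponent 0, so the convolution collapses to
the terms whose second factor carries all of α. Thus slicing is linear over `Conv τ`. -/
theorem slice_incl_mul {σ τ : Type*} [Finite σ] [Finite τ] (α : σ →₀ ℕ) (u : Conv τ)
    (g : Conv (σ ⊕ τ)) : slice α (incl σ τ u * g) = u * slice α g := by
  classical
  refine Conv.ext_coeff fun m => ?_
  rw [coeff_slice, MulMemClass.coe_mul, MulMemClass.coe_mul, MvPowerSeries.coeff_mul,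
    MvPowerSeries.coeff_mul]
  symm
  refine Finset.sum_of_injOn (fun p => (sumElim 0 p.1, sumElim α p.2)) ?_ ?_ ?_ ?_
  · rintro ⟨a, b⟩ - ⟨c, d⟩ - h
    simp only [Prod.mk.injEq] at h
    refine Prod.ext ?_ ?_ <;> ext i
    · exact DFunLike.congr_fun h.1 (Sum.inr i)
    · exact DFunLike.congr_fun h.2 (Sum.inr i)
  · rintro ⟨a, b⟩ h
    simp only [Finset.mem_coe, Finset.HasAntidiagonal.mem_antidiagonal] at h ⊢
    rw [← sumElim_add, h, zero_add]
  · rintro ⟨p, q⟩ hp hn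
    obtain ⟨a, a', rfl⟩ := sumElim_fst_snd p
    obtain ⟨b, b', rfl⟩ := sumElim_fst_snd q
    rw [coeff_incl]
    split_ifs with h
    · exfalso
      subst h
      rw [Finset.HasAntidiagonal.mem_antidiagonal, ← sumElim_add, zero_add] at hp
      have h1 : b = α := by
        ext i; exact DFunLike.congr_fun hp (Sum.inl i)
      have h2 : a' + b' = m := by
        ext i; exact DFunLike.congr_fun hp (Sum.inr i)
      exact hn ⟨(a', b'), by simpa using h2, by simp [h1]⟩
    · rw [zero_mul]
  · rintro ⟨a, b⟩ -
    simp only [coeff_incl, if_pos, coeff_slice]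

theorem slice_X_pow_mul_of_lt {σ τ : Type*} [Finite τ] (α : σ →₀ ℕ) (i : σ) (n : ℕ) (h : α i < n)
    (g : Conv (σ ⊕ τ)) : slice α (Conv.X (Sum.inl i) ^ n * g) = 0 := by
  refine Conv.ext_coeff fun m => ?_
  rw [coeff_slice, Conv.coeff_X_pow_mul, if_neg (by simpa using h)]
  simp

/-- The monomial `x^α`. -/
def monomialInl {σ : Type*} (τ : Type*) (α : σ →₀ ℕ) : Conv (σ ⊕ τ) :=
  ⟨MvPowerSeries.monomial (sumElim α 0) 1, mem_conv.2 (IsConvergent.monomial _ _)⟩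

/-- These products realize prescribed slices, both to prove surjectivity of `boxSlices` and to
rebuild a germ from its slices. -/
theorem slice_monomialInl_mul_incl {σ τ : Type*} [Finite σ] [Finite τ] [DecidableEq σ]
    (α β : σ →₀ ℕ) (u : Conv τ) :
    slice β (monomialInl τ α * incl σ τ u) = if α = β then u else 0 := by
  refine Conv.ext_coeff fun m => ?_
  rw [coeff_slice, MulMemClass.coe_mul, monomialInl, coeff_monomial_mul, one_mul]
  have hle : sumElim α (0 : τ →₀ ℕ) ≤ sumElim β m ↔ α ≤ β :=
    ⟨fun h i => h (Sum.inl i), fun h => by rintro (i | i); exacts [h i, by simp]⟩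
  have hsub : sumElim β m - sumElim α (0 : τ →₀ ℕ) = sumElim (β - α) m := by
    ext (i | i) <;> simp
  rw [hsub, coeff_incl]
  by_cases h : α = β
  · subst h
    simp [hle]
  · rw [if_neg h]
    split_ifs with h1 h2
    · exact absurd (le_antisymm (hle.1 h1) (tsub_eq_zero_iff_le.1 h2)) h
    · simp
    · simp

/-! ### Splitting off the powers of the first variables -/

section Product

variable {σ τ : Type*} [Fintype σ] [Finite τ] (n : σ → ℕ) (J : Ideal (Conv τ))

/-- The exponent with prescribed entries below `n`. -/
def boxExponent (α : ∀ i, Fin (n i)) : σ →₀ ℕ :=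
  equivFunOnFinite.symm fun i => α i

theorem boxExponent_lt (α : ∀ i, Fin (n i)) (i : σ) : boxExponent n α i < n i := by
  simp [boxExponent]

theorem boxExponent_injective : Function.Injective (boxExponent n) := by
  intro α β h
  ext i
  exact DFunLike.congr_fun h i

/-- The coefficients of `x^α`, for all `α < n`, modulo the ideal `J`. -/
def boxSlices : Conv (σ ⊕ τ) →ₗ[ℂ] ((∀ i, Fin (n i)) → Conv τ ⧸ J) :=
  LinearMap.pi fun α => (Ideal.Quotient.mkₐ ℂ J).toLinearMap.comp (slice (boxExponent n α))

theorem boxSlices_apply (g : Conv (σ ⊕ τ)) (α : ∀ i, Fin (n i)) :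
    boxSlices n J g α = Ideal.Quotient.mk J (slice (boxExponent n α) g) := rfl

/-- The ideal generated by `J` and by the powers `X i ^ n i` of the first variables. -/
def boxIdeal : Ideal (Conv (σ ⊕ τ)) :=
  Ideal.span (Set.range fun i : σ => (Conv.X (Sum.inl i) : Conv (σ ⊕ τ)) ^ n i) ⊔
    J.map (incl σ τ)

theorem slice_mem_of_mem_boxIdeal {g : Conv (σ ⊕ τ)} (hg : g ∈ boxIdeal n J) {α : σ →₀ ℕ}
    (hα : ∀ i, α i < n i) : slice α g ∈ J := by
  -- Slicing is not linear over the whole ring, so the induction carries an arbitrary multiplier.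
  suffices h : ∀ a : Conv (σ ⊕ τ), slice α (a * g) ∈ J by simpa using h 1
  rw [boxIdeal, Ideal.map, ← Ideal.span_union] at hg
  induction hg using Submodule.span_induction with
  | mem x hx =>
    intro a
    rcases hx with ⟨i, rfl⟩ | ⟨u, hu, rfl⟩
    · rw [mul_comm, slice_X_pow_mul_of_lt _ _ _ (hα i)]
      exact zero_mem _
    · rw [mul_comm]
      erw [slice_incl_mul]
      exact Ideal.mul_mem_right _ _ hu
  | zero => intro a; simp
  | add x y _ _ hx hy => intro a; rw [mul_add, map_add]; exact add_mem (hx a) (hy a)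
  | smul r x _ hx => intro a; rw [smul_eq_mul, ← mul_assoc]; exact hx _

/-- Subtracting the part p of g with x-exponents in the box leaves only monomials divisible by some
`X i ^ n i`, while p itself lies in the extension of J. -/
theorem mem_boxIdeal_of_slice_mem {g : Conv (σ ⊕ τ)}
    (hg : ∀ α : ∀ i, Fin (n i), slice (boxExponent n α) g ∈ J) : g ∈ boxIdeal n J := by
  classical
  let p : Conv (σ ⊕ τ) := ∑ α : ∀ i, Fin (n i),
    monomialInl τ (boxExponent n α) * incl σ τ (slice (boxExponent n α) g)
  have hp : p ∈ boxIdeal n J := Ideal.sum_mem _ fun α _ => Ideal.mul_mem_left _ _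
    (Ideal.mem_sup_right (Ideal.mem_map_of_mem _ (hg α)))
  have hr : g - p ∈ boxIdeal n J := by
    refine Ideal.mem_sup_left (mem_span_X_pow (fun i : σ => Sum.inl i) n _ fun m hm => ?_)
    obtain ⟨β, m, rfl⟩ := sumElim_fst_snd m
    let β' : ∀ i, Fin (n i) := fun i => ⟨β i, hm i⟩
    have hβ : β = boxExponent n β' := by ext i; rfl
    rw [← coeff_slice, map_sub, map_sum]
    simp only [slice_monomialInl_mul_incl, hβ, (boxExponent_injective n).eq_iff]
    simp
  simpa using add_mem hr hp

theorem ker_boxSlices :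
    LinearMap.ker (boxSlices n J) = (boxIdeal n J).restrictScalars ℂ := by
  ext g
  rw [LinearMap.mem_ker, Submodule.restrictScalars_mem]
  constructor
  · intro h
    exact mem_boxIdeal_of_slice_mem n J fun α => Ideal.Quotient.eq_zero_iff_mem.1 (congrFun h α)
  · intro h
    ext α
    exact Ideal.Quotient.eq_zero_iff_mem.2 (slice_mem_of_mem_boxIdeal n J h (boxExponent_lt n α))

theorem boxSlices_surjective : Function.Surjective (boxSlices n J) := by
  classical
  intro w
  choose u hu using fun α => Ideal.Quotient.mk_surjective (w α)
  refine ⟨∑ α, monomialInl τ (boxExponent n α) * incl σ τ (u α), ?_⟩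
  ext β
  rw [boxSlices_apply, map_sum]
  simp only [slice_monomialInl_mul_incl, (boxExponent_injective n).eq_iff]
  simp [hu]

/-- The quotient by `boxIdeal n J` is a product of copies of the quotient by `J`. -/
def boxQuotientEquiv :
    (Conv (σ ⊕ τ) ⧸ boxIdeal n J) ≃ₗ[ℂ] ((∀ i, Fin (n i)) → Conv τ ⧸ J) :=
  (Submodule.Quotient.restrictScalarsEquiv ℂ (boxIdeal n J)).symm ≪≫ₗ
    Submodule.quotEquivOfEq _ _ (ker_boxSlices n J).symm ≪≫ₗ
      (boxSlices n J).quotKerEquivOfSurjective (boxSlices_surjective n J)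

theorem finite_boxQuotient [Module.Finite ℂ (Conv τ ⧸ J)] :
    Module.Finite ℂ (Conv (σ ⊕ τ) ⧸ boxIdeal n J) :=
  Module.Finite.equiv (boxQuotientEquiv n J).symm

theorem finrank_boxQuotient [Module.Finite ℂ (Conv τ ⧸ J)] :
    Module.finrank ℂ (Conv (σ ⊕ τ) ⧸ boxIdeal n J) =
      (∏ i, n i) * Module.finrank ℂ (Conv τ ⧸ J) := by
  classical
  have : Module.Free ℂ (Conv τ ⧸ J) := Module.Free.of_divisionRing ℂ _
  rw [(boxQuotientEquiv n J).finrank_eq, Module.finrank_pi_fintype]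
  simp

end Product

/-! ### Lines in the plane and their intersection numbers -/

/-- The exponent of `y^i z^j`. -/
def pairExponent (i j : ℕ) : Fin 2 →₀ ℕ := single 0 i + single 1 j

@[simp] theorem pairExponent_zero (i j : ℕ) : pairExponent i j 0 = i := by simp [pairExponent]

@[simp] theorem pairExponent_one (i j : ℕ) : pairExponent i j 1 = j := by simp [pairExponent]

theorem eq_pairExponent (m : Fin 2 →₀ ℕ) : m = pairExponent (m 0) (m 1) := by
  ext i
  fin_cases i <;> simp

theorem degree_pairExponent (i j : ℕ) : (pairExponent i j).degree = i + j := by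
  simp [pairExponent]

theorem pairExponent_sub_single_zero (i j : ℕ) :
    pairExponent (i + 1) j - single 0 1 = pairExponent i j := by
  ext k
  fin_cases k <;> simp

theorem pairExponent_sub_single_one (i j : ℕ) :
    pairExponent i (j + 1) - single 1 1 = pairExponent i j := by
  ext k
  fin_cases k <;> simp

/-- The equation `z - ζ y` of a line. -/
def lineForm (ζ : ℂ) : Conv (Fin 2) := Conv.X 1 - ζ • Conv.X 0

theorem lineForm_ne_zero (ζ : ℂ) : lineForm ζ ≠ 0 := by
  intro h
  have := congrArg (fun f : Conv (Fin 2) => coeff (single 1 1) (f : MvPowerSeries (Fin 2) ℂ)) h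
  simp [lineForm, MvPowerSeries.coeff_X, Finsupp.single_left_inj] at this

theorem coeff_lineForm_mul (ζ : ℂ) (g : Conv (Fin 2)) (i j : ℕ) :
    coeff (pairExponent i (j + 1)) ((lineForm ζ * g : Conv (Fin 2)) : MvPowerSeries (Fin 2) ℂ) =
      coeff (pairExponent i j) (g : MvPowerSeries (Fin 2) ℂ) -
        ζ * (if 1 ≤ i then coeff (pairExponent (i - 1) (j + 1)) (g : MvPowerSeries (Fin 2) ℂ)
          else 0) := by
  have h0 := Conv.coeff_X_pow_mul (0 : Fin 2) 1 g (pairExponent i (j + 1))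
  have h1 := Conv.coeff_X_pow_mul (1 : Fin 2) 1 g (pairExponent i (j + 1))
  rw [pow_one] at h0 h1
  have hexp : lineForm ζ * g = Conv.X 1 * g - ζ • (Conv.X 0 * g) := by
    rw [lineForm, sub_mul, smul_mul_assoc]
  rw [hexp, AddSubgroupClass.coe_sub, map_sub, h1, SetLike.val_smul, MvPowerSeries.coeff_smul, h0,
    pairExponent_one, if_pos (Nat.le_add_left 1 j), pairExponent_sub_single_one, pairExponent_zero]
  congr 2
  split_ifs with h
  · obtain ⟨i, rfl⟩ := Nat.exists_eq_add_of_le' h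
    rw [pairExponent_sub_single_zero, Nat.add_sub_cancel]
  · rfl

/-- Division with remainder by `z - ζ y`: the remainder depends only on `y`. -/
theorem exists_eq_lineForm_mul_add {ζ : ℂ} (hζ : ‖ζ‖ = 1) (f : Conv (Fin 2)) :
    ∃ g r : Conv (Fin 2), f = lineForm ζ * g + r ∧
      ∀ m : Fin 2 →₀ ℕ, m 1 ≠ 0 → coeff m (r : MvPowerSeries (Fin 2) ℂ) = 0 := by
  -- Comparing coefficients of y^i z^(j+1) forces g_(i,j) = f_(i,j+1) + ζ g_(i-1,j+1); this sum is
  -- the recursion unrolled.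
  let G : MvPowerSeries (Fin 2) ℂ := fun m => ∑ q ∈ Finset.range (m 0 + 1),
    ζ ^ q * coeff (pairExponent (m 0 - q) (m 1 + q + 1)) (f : MvPowerSeries (Fin 2) ℂ)
  have hG : ∀ i j, coeff (pairExponent i j) G = ∑ q ∈ Finset.range (i + 1),
      ζ ^ q * coeff (pairExponent (i - q) (j + q + 1)) (f : MvPowerSeries (Fin 2) ℂ) := by
    intro i j
    change ∑ q ∈ Finset.range (pairExponent i j 0 + 1), _ = _
    simp
  have hconv : G ∈ Conv (Fin 2) := by
    obtain ⟨C, R, hC, hR, hb⟩ := (mem_conv.1 f.2).exists_bound_pos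
    refine mem_conv.2 (isConvergent_of_bound (C := C * R) (R := 2 * R) (by linarith) fun m => ?_)
    rw [eq_pairExponent m, hG]
    generalize m 0 = i
    generalize m 1 = j
    have hterm : ∀ q ∈ Finset.range (i + 1),
        ‖ζ ^ q * coeff (pairExponent (i - q) (j + q + 1)) (f : MvPowerSeries (Fin 2) ℂ)‖ ≤
          C * R ^ (i + j + 1) := by
      intro q hq
      rw [norm_mul, norm_pow, hζ, one_pow, one_mul]
      refine (hb _).trans (le_of_eq ?_)
      rw [degree_pairExponent]
      rw [Finset.mem_range] at hq
      congr 2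
      omega
    refine (norm_sum_le_of_le _ hterm).trans ?_
    rw [Finset.sum_const, Finset.card_range, nsmul_eq_mul, degree_pairExponent, mul_pow]
    -- Since ‖ζ‖ = 1 the i + 1 summands obey one common bound; their number is absorbed by doubling
    -- R.
    have h2 : ((i + 1 : ℕ) : ℝ) ≤ 2 ^ (i + j) := by
      have h3 : i + 1 ≤ 2 ^ (i + j) :=
        (Nat.lt_two_pow_self (n := i)).trans_le (Nat.pow_le_pow_right two_pos (by omega))
      exact_mod_cast h3
    calc ((i + 1 : ℕ) : ℝ) * (C * R ^ (i + j + 1)) ≤ 2 ^ (i + j) * (C * R ^ (i + j + 1)) := by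
          gcongr
      _ = C * R * (2 ^ (i + j) * R ^ (i + j)) := by ring
  refine ⟨⟨G, hconv⟩, f - lineForm ζ * ⟨G, hconv⟩, by ring, fun m hm => ?_⟩
  obtain ⟨j, hj⟩ := Nat.exists_eq_succ_of_ne_zero hm
  rw [eq_pairExponent m, hj, AddSubgroupClass.coe_sub, map_sub, Nat.succ_eq_add_one,
    coeff_lineForm_mul, sub_eq_zero]
  simp only [hG]
  rcases m 0 with _ | i
  · simp
  · rw [if_pos (by omega), Finset.sum_range_succ', Finset.mul_sum]
    simp only [Nat.add_sub_cancel]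
    rw [Finset.sum_congr rfl fun q _ => show
        ζ ^ (q + 1) * coeff (pairExponent (i + 1 - (q + 1)) (j + (q + 1) + 1))
            (f : MvPowerSeries (Fin 2) ℂ) =
          ζ * (ζ ^ q * coeff (pairExponent (i - q) (j + 1 + q + 1))
            (f : MvPowerSeries (Fin 2) ℂ)) by
      rw [show i + 1 - (q + 1) = i - q by omega, show j + (q + 1) + 1 = j + 1 + q + 1 by omega]
      ring]
    simp

/-- The parametrization `y ↦ (y, ζ y)` of a line. -/
def lineParam (ζ : ℂ) : Fin 2 → PowerSeries ℂ := ![PowerSeries.X, PowerSeries.C ζ * PowerSeries.X]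

theorem hasSubst_lineParam (ζ : ℂ) :
    MvPowerSeries.HasSubst (S := ℂ) (τ := Unit) (lineParam ζ) := by
  refine MvPowerSeries.hasSubst_of_constantCoeff_zero fun i => ?_
  change PowerSeries.constantCoeff (lineParam ζ i) = 0
  fin_cases i <;> simp [lineParam]

/-- Restriction of a germ to the line `z = ζ y`. -/
def evalLine (ζ : ℂ) : Conv (Fin 2) →ₐ[ℂ] PowerSeries ℂ :=
  (show MvPowerSeries (Fin 2) ℂ →ₐ[ℂ] PowerSeries ℂ from
    MvPowerSeries.substAlgHom (hasSubst_lineParam ζ)).comp (Conv (Fin 2)).val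

theorem evalLine_X (ζ : ℂ) (i : Fin 2) : evalLine ζ (Conv.X i) = lineParam ζ i :=
  MvPowerSeries.substAlgHom_X (hasSubst_lineParam ζ) i

theorem evalLine_lineForm (ζ : ℂ) : evalLine ζ (lineForm ζ) = 0 := by
  rw [lineForm, map_sub, map_smul, evalLine_X, evalLine_X]
  simp [lineParam, PowerSeries.smul_eq_C_mul]

/-- A remainder in y alone is unchanged by y ↦ (y, ζy), so it can be read off from its restriction
to the line. -/
theorem coeff_evalLine_of_coeff_eq_zero (ζ : ℂ) (r : Conv (Fin 2))
    (hr : ∀ m : Fin 2 →₀ ℕ, m 1 ≠ 0 → coeff m (r : MvPowerSeries (Fin 2) ℂ) = 0) (s : ℕ) :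
    PowerSeries.coeff s (evalLine ζ r) =
      coeff (pairExponent s 0) (r : MvPowerSeries (Fin 2) ℂ) := by
  have h := MvPowerSeries.coeff_subst (hasSubst_lineParam ζ) (r : MvPowerSeries (Fin 2) ℂ)
    (single () s)
  have hprod : ∀ d : Fin 2 →₀ ℕ, d.prod (fun i e => lineParam ζ i ^ e) =
      PowerSeries.C (ζ ^ d 1) * PowerSeries.X ^ (d 0 + d 1) := by
    intro d
    rw [Finsupp.prod_fintype _ _ (by simp), Fin.prod_univ_two]
    simp [lineParam]
    ring
  have hterm : ∀ d : Fin 2 →₀ ℕ, d ≠ pairExponent s 0 →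
      coeff d (r : MvPowerSeries (Fin 2) ℂ) •
        PowerSeries.coeff s (d.prod fun i e => lineParam ζ i ^ e) = 0 := by
    intro d hd
    by_cases h1 : d 1 = 0
    · rw [hprod, h1, pow_zero, map_one, one_mul, PowerSeries.coeff_X_pow, if_neg, smul_zero]
      rintro rfl
      apply hd
      rw [eq_pairExponent d, h1]
      simp
    · rw [hr d h1, zero_smul]
  calc PowerSeries.coeff s (evalLine ζ r)
      = MvPowerSeries.coeff (single () s) (MvPowerSeries.subst (lineParam ζ)
          (r : MvPowerSeries (Fin 2) ℂ)) := by
        rw [← MvPowerSeries.coe_substAlgHom (hasSubst_lineParam ζ)]; rfl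
    _ = ∑ᶠ d : Fin 2 →₀ ℕ, coeff d (r : MvPowerSeries (Fin 2) ℂ) •
        PowerSeries.coeff s (d.prod fun i e => lineParam ζ i ^ e) := h
    _ = coeff (pairExponent s 0) (r : MvPowerSeries (Fin 2) ℂ) := by
        rw [finsum_eq_single _ _ hterm, hprod]
        simp [PowerSeries.coeff_X_pow]

/-- After division by the line, only the remainder survives restriction, and it survives intact;
hence it is zero. -/
theorem lineForm_dvd_of_evalLine_eq_zero {ζ : ℂ} (hζ : ‖ζ‖ = 1) {f : Conv (Fin 2)}
    (hf : evalLine ζ f = 0) : lineForm ζ ∣ f := by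
  obtain ⟨g, r, rfl, hr⟩ := exists_eq_lineForm_mul_add hζ f
  rw [map_add, map_mul, evalLine_lineForm, zero_mul, zero_add] at hf
  have h0 : r = 0 := by
    refine Conv.ext_coeff fun m => ?_
    by_cases h1 : m 1 = 0
    · rw [eq_pairExponent m, h1, ← coeff_evalLine_of_coeff_eq_zero ζ r hr, hf]
      simp
    · rw [hr m h1]; simp
  simp [h0]

/-- The first `b` coefficients of the restriction to the line `z = ζ y`. -/
def lineJet (ζ : ℂ) (b : ℕ) : Conv (Fin 2) →ₗ[ℂ] (Fin b → ℂ) :=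
  LinearMap.pi fun s => (PowerSeries.coeff (R := ℂ) s).comp (evalLine ζ).toLinearMap

theorem lineJet_apply (ζ : ℂ) (b : ℕ) (f : Conv (Fin 2)) (s : Fin b) :
    lineJet ζ b f s = PowerSeries.coeff s (evalLine ζ f) := rfl

theorem lineJet_surjective (ζ : ℂ) (b : ℕ) : Function.Surjective (lineJet ζ b) := by
  intro w
  refine ⟨∑ t : Fin b, w t • Conv.X 0 ^ (t : ℕ), ?_⟩
  ext s
  rw [lineJet_apply, map_sum, map_sum]
  simp only [map_smul, map_pow, evalLine_X]
  simp [lineParam, PowerSeries.coeff_X_pow, Fin.val_inj]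

theorem ker_lineJet {ζ : ℂ} (hζ : ‖ζ‖ = 1) {b : ℕ} {Q : Conv (Fin 2)} {c : ℂ} (hc : c ≠ 0)
    (hQ : evalLine ζ Q = PowerSeries.C c * PowerSeries.X ^ b) :
    LinearMap.ker (lineJet ζ b) = (Ideal.span {lineForm ζ, Q}).restrictScalars ℂ := by
  ext f
  rw [LinearMap.mem_ker, Submodule.restrictScalars_mem]
  constructor
  · intro hf
    -- Q and c y^b agree on the line, so Q may be traded for y^b in the ideal, c being invertible.
    obtain ⟨w, hw⟩ := lineForm_dvd_of_evalLine_eq_zero hζ (f := Q - c • Conv.X 0 ^ b) (by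
      rw [map_sub, map_smul, map_pow, evalLine_X, hQ]
      simp [lineParam, PowerSeries.smul_eq_C_mul])
    obtain ⟨g, r, rfl, hr⟩ := exists_eq_lineForm_mul_add hζ f
    have hr' : r ∈ Ideal.span (Set.range fun _ : Unit => (Conv.X 0 : Conv (Fin 2)) ^ b) := by
      refine mem_span_X_pow (fun _ : Unit => 0) (fun _ => b) r fun m hm => ?_
      by_cases h1 : m 1 = 0
      · have := congrFun hf ⟨m 0, hm ()⟩
        rw [lineJet_apply, map_add, map_mul, evalLine_lineForm, zero_mul, zero_add,
          coeff_evalLine_of_coeff_eq_zero ζ r hr] at this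
        rw [eq_pairExponent m, h1]
        exact this
      · exact hr m h1
    rw [Set.range_const, Ideal.mem_span_singleton] at hr'
    obtain ⟨u, rfl⟩ := hr'
    refine Ideal.mem_span_pair.2 ⟨g - c⁻¹ • (w * u), c⁻¹ • u, ?_⟩
    have hX : (Conv.X 0 : Conv (Fin 2)) ^ b = c⁻¹ • (Q - lineForm ζ * w) := by
      rw [← hw, sub_sub_cancel, smul_smul, inv_mul_cancel₀ hc, one_smul]
    rw [hX]
    simp only [Algebra.smul_def]
    ring
  · intro hf
    obtain ⟨u, v, rfl⟩ := Ideal.mem_span_pair.1 hf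
    ext s
    rw [lineJet_apply, map_add, map_mul, map_mul, evalLine_lineForm, hQ, mul_zero, zero_add,
      mul_left_comm, PowerSeries.coeff_C_mul, PowerSeries.coeff_mul_X_pow', if_neg (by omega)]
    simp

theorem finrank_quotient_lineForm {ζ : ℂ} (hζ : ‖ζ‖ = 1) {b : ℕ} {Q : Conv (Fin 2)} {c : ℂ}
    (hc : c ≠ 0) (hQ : evalLine ζ Q = PowerSeries.C c * PowerSeries.X ^ b) :
    Module.Finite ℂ (Conv (Fin 2) ⧸ Ideal.span {lineForm ζ, Q}) ∧
      Module.finrank ℂ (Conv (Fin 2) ⧸ Ideal.span {lineForm ζ, Q}) = b := by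
  let e : (Conv (Fin 2) ⧸ Ideal.span {lineForm ζ, Q}) ≃ₗ[ℂ] (Fin b → ℂ) :=
    (Submodule.Quotient.restrictScalarsEquiv ℂ _).symm ≪≫ₗ
      Submodule.quotEquivOfEq _ _ (ker_lineJet hζ hc hQ).symm ≪≫ₗ
        (lineJet ζ b).quotKerEquivOfSurjective (lineJet_surjective ζ b)
  exact ⟨Module.Finite.equiv e.symm, by rw [e.finrank_eq]; simp⟩

/-- On the line the relation becomes 0 = Q v in the domain of power series. As Q does not vanish
there, v does, so v is divisible by the line, which can then be cancelled. -/
theorem exists_eq_mul_of_lineForm_mul_eq {ζ : ℂ} (hζ : ‖ζ‖ = 1) {Q u v : Conv (Fin 2)}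
    (hQ : evalLine ζ Q ≠ 0) (h : lineForm ζ * u = Q * v) : ∃ w, u = Q * w := by
  have h1 : evalLine ζ Q * evalLine ζ v = 0 := by
    rw [← map_mul, ← h, map_mul, evalLine_lineForm, zero_mul]
  obtain ⟨w, rfl⟩ :=
    lineForm_dvd_of_evalLine_eq_zero hζ ((mul_eq_zero.1 h1).resolve_left hQ)
  exact ⟨w, mul_left_cancel₀ (lineForm_ne_zero ζ) (by rw [h]; ring)⟩

/-- The intersection number at the origin of a union of lines with a curve not containing any of
them. -/
theorem finrank_quotient_prod_lineForm {b : ℕ} {Q : Conv (Fin 2)} (S : Finset ℂ)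
    (hS : ∀ ζ ∈ S, ‖ζ‖ = 1 ∧
      ∃ c : ℂ, c ≠ 0 ∧ evalLine ζ Q = PowerSeries.C c * PowerSeries.X ^ b) :
    Module.Finite ℂ (Conv (Fin 2) ⧸ Ideal.span {∏ ζ ∈ S, lineForm ζ, Q}) ∧
      Module.finrank ℂ (Conv (Fin 2) ⧸ Ideal.span {∏ ζ ∈ S, lineForm ζ, Q}) = S.card * b := by
  induction S using Finset.induction_on with
  | empty =>
    have htop : Ideal.span {∏ ζ ∈ (∅ : Finset ℂ), lineForm ζ, Q} = ⊤ :=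
      (Ideal.eq_top_iff_one _).2 (Ideal.subset_span (by simp))
    have : Subsingleton (Conv (Fin 2) ⧸ Ideal.span {∏ ζ ∈ (∅ : Finset ℂ), lineForm ζ, Q}) :=
      Ideal.Quotient.subsingleton_iff.2 htop
    exact ⟨inferInstance, by rw [Module.finrank_zero_of_subsingleton]; simp⟩
  | insert ζ S hζS ih =>
    obtain ⟨hfin, hrank⟩ := ih fun ζ hζ => hS ζ (Finset.mem_insert_of_mem hζ)
    obtain ⟨hζ, c, hc, hQ⟩ := hS ζ (Finset.mem_insert_self _ _)
    obtain ⟨hfin', hrank'⟩ := finrank_quotient_lineForm hζ hc hQ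
    have hQ0 : evalLine ζ Q ≠ 0 := by
      rw [hQ]
      exact mul_ne_zero (by simpa using hc) (pow_ne_zero _ PowerSeries.X_ne_zero)
    obtain ⟨h1, h2⟩ := finrank_quotient_span_mul (∏ ζ ∈ S, lineForm ζ) (lineForm ζ) Q
      fun u v => exists_eq_mul_of_lineForm_mul_eq hζ hQ0
    rw [Finset.prod_insert hζS, mul_comm]
    refine ⟨h1, ?_⟩
    rw [h2, hrank, hrank', Finset.card_insert_of_notMem hζS]
    ring

/-! ### Colength of the divided differences of two coprime powers -/

/-- The divided difference `(z^m - y^m) / (z - y)` of the `m`-th power. -/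
def powDiff {R : Type*} [CommRing R] (m : ℕ) (y z : R) : R :=
  ∑ i ∈ Finset.range m, z ^ i * y ^ (m - 1 - i)

theorem sub_mul_powDiff {R : Type*} [CommRing R] (m : ℕ) (y z : R) :
    (z - y) * powDiff m y z = z ^ m - y ^ m := by
  rw [mul_comm]
  exact geom_sum₂_mul z y m

theorem map_powDiff {R S F : Type*} [CommRing R] [CommRing S] [FunLike F R S] [RingHomClass F R S]
    (f : F) (m : ℕ) (y z : R) : f (powDiff m y z) = powDiff m (f y) (f z) := by
  simp [powDiff]

theorem lineForm_one : lineForm 1 = Conv.X 1 - Conv.X 0 := by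
  rw [lineForm, one_smul]

/-- Over all m-th roots of unity the lines multiply to z^m - y^m; the root 1 accounts for the factor
z - y. -/
theorem powDiff_eq_prod_lineForm {m : ℕ} (hm : 0 < m) :
    powDiff m (Conv.X 0 : Conv (Fin 2)) (Conv.X 1) =
      ∏ ζ ∈ (Polynomial.nthRootsFinset m (1 : ℂ)).erase 1, lineForm ζ := by
  have : NeZero m := ⟨hm.ne'⟩
  have : IsDomain (Conv (Fin 2)) := NoZeroDivisors.to_isDomain _
  apply mul_left_cancel₀ (lineForm_ne_zero 1)
  rw [Finset.mul_prod_erase _ lineForm ((Polynomial.mem_nthRootsFinset hm 1).2 (one_pow m)),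
    lineForm_one, sub_mul_powDiff]
  have hprim := (Complex.isPrimitiveRoot_exp m hm.ne').map_of_injective
    (f := algebraMap ℂ (Conv (Fin 2))) (algebraMap ℂ (Conv (Fin 2))).injective
  rw [hprim.pow_sub_pow_eq_prod_sub_mul (Conv.X 1) (Conv.X 0) hm]
  symm
  refine Finset.prod_bij (fun ζ _ => algebraMap ℂ _ ζ) ?_ ?_ ?_ ?_
  · intro ζ hζ
    rw [Polynomial.mem_nthRootsFinset hm] at hζ ⊢
    rw [← map_pow, hζ, map_one]
  · intro a _ b _ h
    exact (algebraMap ℂ (Conv (Fin 2))).injective h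
  · intro ξ hξ
    obtain ⟨i, -, rfl⟩ := hprim.eq_pow_of_pow_eq_one ((Polynomial.mem_nthRootsFinset hm 1).1 hξ)
    refine ⟨Complex.exp (2 * Real.pi * Complex.I / m) ^ i, ?_, map_pow _ _ _⟩
    rw [Polynomial.mem_nthRootsFinset hm, ← pow_mul, pow_mul',
      (Complex.isPrimitiveRoot_exp m hm.ne').pow_eq_one, one_pow]
  · intro ζ _
    rw [lineForm, Algebra.smul_def]

theorem evalLine_powDiff (m : ℕ) (ζ : ℂ) :
    evalLine ζ (powDiff m (Conv.X 0) (Conv.X 1)) =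
      PowerSeries.C (∑ i ∈ Finset.range m, ζ ^ i) * PowerSeries.X ^ (m - 1) := by
  rw [map_powDiff, evalLine_X, evalLine_X, powDiff, map_sum, Finset.sum_mul]
  refine Finset.sum_congr rfl fun i hi => ?_
  rw [Finset.mem_range] at hi
  simp only [lineParam, Matrix.cons_val_zero, Matrix.cons_val_one, mul_pow, map_pow, mul_assoc,
    ← pow_add]
  congr 2
  omega

theorem finrank_quotient_powDiff {a b : ℕ} (ha : 0 < a) (h : Nat.gcd a b = 1) :
    Module.Finite ℂ (Conv (Fin 2) ⧸
      Ideal.span {powDiff a (Conv.X 0 : Conv (Fin 2)) (Conv.X 1), powDiff b (Conv.X 0) (Conv.X 1)}) ∧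
    Module.finrank ℂ (Conv (Fin 2) ⧸
      Ideal.span {powDiff a (Conv.X 0 : Conv (Fin 2)) (Conv.X 1), powDiff b (Conv.X 0) (Conv.X 1)})
        = (a - 1) * (b - 1) := by
  have hcard : ((Polynomial.nthRootsFinset a (1 : ℂ)).erase 1).card = a - 1 := by
    rw [Finset.card_erase_of_mem ((Polynomial.mem_nthRootsFinset ha 1).2 (one_pow a)),
      (Complex.isPrimitiveRoot_exp a ha.ne').card_nthRootsFinset]
  rw [powDiff_eq_prod_lineForm ha, ← hcard]
  refine finrank_quotient_prod_lineForm _ fun ζ hζ => ?_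
  rw [Finset.mem_erase, Polynomial.mem_nthRootsFinset ha] at hζ
  refine ⟨Complex.norm_eq_one_of_pow_eq_one hζ.2 ha.ne', _, fun h0 => ?_, evalLine_powDiff b ζ⟩
  apply hζ.1
  -- A vanishing geometric sum would make ζ a root of unity of order dividing both a and b, hence ζ
  -- = 1.
  have hb : ζ ^ b = 1 := by
    rw [← sub_eq_zero, ← geom_sum_mul, h0, zero_mul]
  have := pow_gcd_eq_one.2 ⟨hζ.2, hb⟩
  rwa [h, pow_one] at this

/-! ### The delta invariant of a monomial curve -/

section Delta

variable {a b : ℕ} {φ : MapGerm (Fin 1) (Fin 2)}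

theorem coeff_subst_monomialCurve (hφ : φ.comp = ![Conv.X 0 ^ a, Conv.X 0 ^ b])
    (v : MvPowerSeries (Fin 2) ℂ) (s : ℕ) :
    coeff (single 0 s) (substAlgHom (R := ℂ) φ.hasSubst v) =
      ∑ᶠ d : Fin 2 →₀ ℕ, if s = d 0 * a + d 1 * b then coeff d v else 0 := by
  rw [coe_substAlgHom, coeff_subst φ.hasSubst]
  refine finsum_congr fun d => ?_
  have hprod : d.prod (fun t e => (φ.comp t : MvPowerSeries (Fin 1) ℂ) ^ e) =
      MvPowerSeries.X 0 ^ (d 0 * a + d 1 * b) := by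
    rw [Finsupp.prod_fintype _ _ (by simp), Fin.prod_univ_two, hφ]
    simp only [Matrix.cons_val_zero, Matrix.cons_val_one, SubmonoidClass.coe_pow, Conv.coe_X]
    ring
  rw [hprod, MvPowerSeries.coeff_X_pow]
  simp only [(Finsupp.single_injective (0 : Fin 1)).eq_iff, smul_eq_mul, mul_ite, mul_one, mul_zero]

theorem mem_pullback_monomialCurve (hφ : φ.comp = ![Conv.X 0 ^ a, Conv.X 0 ^ b])
    (g : Conv (Fin 1)) :
    g ∈ φ.pullback ↔ ∀ s : ℕ, ¬ IsRepresentable a b s →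
      coeff (single 0 s) (g : MvPowerSeries (Fin 1) ℂ) = 0 := by
  classical
  have hmem : g ∈ φ.pullback ↔ ∃ v ∈ Conv (Fin 2),
      substAlgHom (R := ℂ) φ.hasSubst v = (g : MvPowerSeries (Fin 1) ℂ) := Iff.rfl
  rw [hmem]
  constructor
  · rintro ⟨v, -, hv⟩ s hs
    rw [← hv, coeff_subst_monomialCurve hφ]
    refine finsum_eq_zero_of_forall_eq_zero fun d => if_neg fun h => hs ⟨d 0, d 1, ?_⟩
    exact_mod_cast h
  · intro hg
    have hrep : ∀ s : ℕ, ∃ d : Fin 2 →₀ ℕ, IsRepresentable a b s → s = d 0 * a + d 1 * b := by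
      intro s
      by_cases h : IsRepresentable a b s
      · obtain ⟨i, j, hij⟩ := h
        refine ⟨pairExponent i j, fun _ => ?_⟩
        rw [pairExponent_zero, pairExponent_one]
        exact_mod_cast hij
      · exact ⟨0, fun h' => absurd h' h⟩
    choose rep hrep using hrep
    -- An s may have several representations. Only the chosen one `rep s` carries the coefficient of
    -- y^s, so nothing is counted twice.
    let v : MvPowerSeries (Fin 2) ℂ := fun d =>
      if d = rep (d 0 * a + d 1 * b) then
        coeff (single 0 (d 0 * a + d 1 * b)) (g : MvPowerSeries (Fin 1) ℂ) else 0
    have hv : ∀ d, coeff d v = if d = rep (d 0 * a + d 1 * b) then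
        coeff (single 0 (d 0 * a + d 1 * b)) (g : MvPowerSeries (Fin 1) ℂ) else 0 := fun d => rfl
    refine ⟨v, ?_, ?_⟩
    · obtain ⟨C, R, hC, hR, hbound⟩ := (mem_conv.1 g.2).exists_bound_pos
      -- The radius constant comes from d₀a + d₁b ≤ (a + b)(d₀ + d₁) and R ≥ 1.
      refine mem_conv.2 (isConvergent_of_bound (C := C) (R := R ^ (a + b)) (by positivity)
        fun d => ?_)
      rw [hv]
      split_ifs
      · refine (hbound _).trans ?_
        rw [degree_single, ← pow_mul]
        refine mul_le_mul_of_nonneg_left (pow_le_pow_right₀ hR ?_) hC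
        · rw [Finsupp.degree_eq_sum, Fin.sum_univ_two]
          nlinarith [Nat.zero_le (d 0 * b), Nat.zero_le (d 1 * a)]
      · simp only [norm_zero]; positivity
    · ext m
      obtain ⟨s, rfl⟩ : ∃ s, m = single 0 s := ⟨m 0, Finsupp.ext fun i => by fin_cases i; simp⟩
      rw [coeff_subst_monomialCurve hφ]
      by_cases hs : IsRepresentable a b s
      · rw [finsum_eq_single _ (rep s)]
        · rw [if_pos (hrep s hs), hv, ← hrep s hs, if_pos rfl]
        · intro d hd
          split_ifs with h
          · rw [hv, ← h, if_neg hd]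
          · rfl
      · rw [hg s hs]
        refine finsum_eq_zero_of_forall_eq_zero fun d => if_neg fun h => hs ⟨d 0, d 1, ?_⟩
        exact_mod_cast h

theorem delta_monomialCurve (hφ : φ.comp = ![Conv.X 0 ^ a, Conv.X 0 ^ b])
    (ha : 0 < a) (hb : 0 < b) (hab : Nat.gcd a b = 1) :
    Module.Finite ℂ (Conv (Fin 1) ⧸ φ.pullback) ∧ 2 * φ.delta = (a - 1) * (b - 1) := by
  classical
  let T : Conv (Fin 1) →ₗ[ℂ] (gaps a b → ℂ) := LinearMap.pi fun s =>
    (MvPowerSeries.coeff (R := ℂ) (single (0 : Fin 1) (s : ℕ))).comp (Conv (Fin 1)).val.toLinearMap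
  have hT : ∀ g s, T g s = coeff (single 0 (s : ℕ)) (g : MvPowerSeries (Fin 1) ℂ) :=
    fun _ _ => rfl
  have hker : LinearMap.ker T = φ.pullback := by
    ext g
    rw [LinearMap.mem_ker, mem_pullback_monomialCurve hφ]
    constructor
    · intro h s hs
      exact congrFun h ⟨s, (mem_gaps ha hb hab s).2 hs⟩
    · intro h
      ext s
      exact h s ((mem_gaps ha hb hab s).1 s.2)
  have hsurj : Function.Surjective T := by
    intro w
    refine ⟨∑ t, w t • Conv.X 0 ^ (t : ℕ), ?_⟩
    ext s
    rw [map_sum, Finset.sum_apply]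
    have : ∀ t : gaps a b, T (w t • Conv.X 0 ^ (t : ℕ)) s = if t = s then w t else 0 := by
      intro t
      rw [map_smul, Pi.smul_apply, hT, SubmonoidClass.coe_pow, Conv.coe_X,
        MvPowerSeries.coeff_X_pow]
      simp only [(Finsupp.single_injective (0 : Fin 1)).eq_iff, SetLike.coe_eq_coe, smul_eq_mul,
        mul_ite, mul_one, mul_zero, eq_comm]
    simp [this]
  let e : (Conv (Fin 1) ⧸ φ.pullback) ≃ₗ[ℂ] (gaps a b → ℂ) :=
    Submodule.quotEquivOfEq _ _ hker.symm ≪≫ₗ T.quotKerEquivOfSurjective hsurj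
  refine ⟨Module.Finite.equiv e.symm, ?_⟩
  rw [MapGerm.delta, e.finrank_eq, Module.finrank_fintype_fun_eq_card, Fintype.card_coe,
    two_mul_card_gaps ha hb hab]

end Delta

/-! ### Double point ideals -/

theorem X_sub_X_ne_zero (k : ℕ) : (MvPowerSeries.X (Sum.inr 1) - MvPowerSeries.X (Sum.inr 0) :
    MvPowerSeries (Fin k ⊕ Fin 2) ℂ) ≠ 0 := by
  intro h
  have := congrArg (coeff (single (Sum.inr 1) 1)) h
  simp [MvPowerSeries.coeff_X, Finsupp.single_left_inj] at this

/-- Cancelling z - y in a domain lets divided differences be identified by an algebraic identity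
instead of by coefficients. -/
theorem dividedDifference_unique {k : ℕ} {g : Conv (Fin k ⊕ Fin 1)} {d : Conv (Fin k ⊕ Fin 2)}
    (h : (MvPowerSeries.X (Sum.inr 1) - MvPowerSeries.X (Sum.inr 0)) *
        (d : MvPowerSeries (Fin k ⊕ Fin 2) ℂ) =
      MvPowerSeries.rename (varMap k 1) (g : MvPowerSeries (Fin k ⊕ Fin 1) ℂ) -
        MvPowerSeries.rename (varMap k 0) (g : MvPowerSeries (Fin k ⊕ Fin 1) ℂ)) :
    dividedDifference g = d :=
  Subtype.ext (mul_left_cancel₀ (X_sub_X_ne_zero k) ((sub_mul_dividedDifference g).trans h.symm))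

theorem dividedDifference_pow (k m : ℕ) :
    dividedDifference (Conv.X (Sum.inr 0) ^ m : Conv (Fin k ⊕ Fin 1)) =
      powDiff m (Conv.X (Sum.inr 0)) (Conv.X (Sum.inr 1)) := by
  refine dividedDifference_unique ?_
  have h := congrArg (Subtype.val) (sub_mul_powDiff m (Conv.X (Sum.inr 0) : Conv (Fin k ⊕ Fin 2))
    (Conv.X (Sum.inr 1)))
  refine h.trans ?_
  simp [varMap]

theorem dividedDifference_X_pow_mul (k n : ℕ) (i : Fin k) :
    dividedDifference (Conv.X (Sum.inl i) ^ n * Conv.X (Sum.inr 0) : Conv (Fin k ⊕ Fin 1)) =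
      Conv.X (Sum.inl i) ^ n := by
  refine dividedDifference_unique ?_
  simp [varMap]
  ring

theorem dividedDifference_sub {k : ℕ} (g h : Conv (Fin k ⊕ Fin 1)) :
    dividedDifference (g - h) = dividedDifference g - dividedDifference h := by
  refine Conv.ext_coeff fun m => ?_
  simp [dividedDifference, coeff_dividedDifferenceSeries]

/-- The ideal generated by the powers `X i ^ n i` and the divided differences of `y^a` and `y^b`. -/
def modelIdeal {k : ℕ} (a b : ℕ) (n : Fin k → ℕ) : Ideal (Conv (Fin k ⊕ Fin 2)) :=
  boxIdeal n (Ideal.span {powDiff a (Conv.X 0 : Conv (Fin 2)) (Conv.X 1),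
    powDiff b (Conv.X 0) (Conv.X 1)})

theorem modelIdeal_eq {k : ℕ} (a b : ℕ) (n : Fin k → ℕ) :
    modelIdeal a b n =
      Ideal.span (Set.range fun i => (Conv.X (Sum.inl i) : Conv (Fin k ⊕ Fin 2)) ^ n i) ⊔
        Ideal.span {dividedDifference (Conv.X (Sum.inr 0) ^ a),
          dividedDifference (Conv.X (Sum.inr 0) ^ b)} := by
  rw [modelIdeal, boxIdeal, Ideal.map_span, Set.image_pair, map_powDiff, map_powDiff, incl_X,
    incl_X, dividedDifference_pow, dividedDifference_pow]

theorem finrank_quotient_modelIdeal {k a b : ℕ} (n : Fin k → ℕ) (ha : 0 < a)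
    (h : Nat.gcd a b = 1) :
    Module.Finite ℂ (Conv (Fin k ⊕ Fin 2) ⧸ modelIdeal a b n) ∧
      Module.finrank ℂ (Conv (Fin k ⊕ Fin 2) ⧸ modelIdeal a b n) =
        (∏ i, n i) * ((a - 1) * (b - 1)) := by
  obtain ⟨hfin, hrank⟩ := finrank_quotient_powDiff ha h
  exact ⟨finite_boxQuotient n _, by rw [modelIdeal, finrank_boxQuotient, hrank]⟩

/-- A monomial free of x in this difference has as coefficient either 0 or the constant term of some
a_j, which vanishes. So every monomial present is divisible by some x_i. -/
theorem dividedDifference_sub_pow_mem {k m : ℕ} {h : Conv (Fin k ⊕ Fin 1)}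
    (hh : IsDeformationOfPower m h) :
    dividedDifference h - dividedDifference (Conv.X (Sum.inr 0) ^ m) ∈
      Ideal.span (Set.range fun i => (Conv.X (Sum.inl i) : Conv (Fin k ⊕ Fin 2)) ^ 1) := by
  obtain ⟨c, hc, hcoeff⟩ := hh
  rw [← dividedDifference_sub]
  refine mem_span_X_pow (fun i => Sum.inl i) (fun _ => 1) _ fun e he => ?_
  have hexp : mergeExponent e = sumElim 0 (single 0 (e (Sum.inr 0) + e (Sum.inr 1) + 1)) := by
    ext (i | i)
    · simpa [mergeExponent] using he i
    · fin_cases i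
      simp [mergeExponent]
  change coeff (mergeExponent e) ((h - Conv.X (Sum.inr 0) ^ m : Conv (Fin k ⊕ Fin 1)) :
    MvPowerSeries (Fin k ⊕ Fin 1) ℂ) = 0
  rw [hexp, hcoeff]
  split_ifs
  · rw [coeff_zero_eq_constantCoeff_apply, hc]
  · rfl

theorem span_pair_sup_eq_of_sub_mem {R : Type*} [CommRing R] (I : Ideal R) {x x' y y' : R}
    (hx : x - x' ∈ I) (hy : y - y' ∈ I) :
    I ⊔ Ideal.span {x, y} = I ⊔ Ideal.span {x', y'} := by
  have key : ∀ {x x' y y' : R}, x - x' ∈ I → y - y' ∈ I →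
      I ⊔ Ideal.span {x, y} ≤ I ⊔ Ideal.span {x', y'} := by
    intro x x' y y' hx hy
    refine sup_le le_sup_left (Ideal.span_le.2 ?_)
    rintro z (rfl | rfl)
    · rw [← sub_add_cancel z x']
      exact add_mem (Ideal.mem_sup_left hx)
        (Ideal.mem_sup_right (Ideal.subset_span (Set.mem_insert _ _)))
    · rw [← sub_add_cancel z y']
      exact add_mem (Ideal.mem_sup_left hy)
        (Ideal.mem_sup_right (Ideal.subset_span (Set.mem_insert_of_mem _ rfl)))
  exact le_antisymm (key hx hy) (key (by simpa using neg_mem hx) (by simpa using neg_mem hy))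

/-- The components x_i y put every x_i into the ideal, and modulo these h₁ and h₂ have the same
divided differences as y^a and y^b. -/
theorem doublePointIdeal_of_deformation {k a b : ℕ} {h₁ h₂ : Conv (Fin k ⊕ Fin 1)}
    (hh₁ : IsDeformationOfPower a h₁) (hh₂ : IsDeformationOfPower b h₂)
    {f : MapGerm (Fin k ⊕ Fin 1) (Fin k ⊕ Fin (k + 2))}
    (hf : (fun i => f.comp (Sum.inr i)) = Fin.append
      (fun i : Fin k => Conv.X (Sum.inl i) * Conv.X (Sum.inr 0)) ![h₁, h₂]) :
    f.doublePointIdeal = modelIdeal a b fun _ => 1 := by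
  have hrange : Set.range (fun i => dividedDifference (f.comp (Sum.inr i))) =
      (Set.range fun i : Fin k => (Conv.X (Sum.inl i) : Conv (Fin k ⊕ Fin 2)) ^ 1) ∪
        {dividedDifference h₁, dividedDifference h₂} := by
    have hcomp : (fun i => dividedDifference (f.comp (Sum.inr i))) = Fin.append
        (fun i : Fin k => (Conv.X (Sum.inl i) : Conv (Fin k ⊕ Fin 2)) ^ 1)
        ![dividedDifference h₁, dividedDifference h₂] := by
      funext i
      rw [congrFun hf i]
      refine Fin.addCases (fun i => ?_) (fun i => ?_) i
      · rw [Fin.append_left, Fin.append_left, ← dividedDifference_X_pow_mul, pow_one]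
      · rw [Fin.append_right, Fin.append_right]
        fin_cases i <;> rfl
    rw [hcomp]
    ext x
    constructor
    · rintro ⟨i, rfl⟩
      refine Fin.addCases (fun i => ?_) (fun i => ?_) i
      · rw [Fin.append_left]
        exact Or.inl ⟨i, rfl⟩
      · rw [Fin.append_right]
        fin_cases i
        · exact Or.inr (Or.inl rfl)
        · exact Or.inr (Or.inr rfl)
    · rintro (⟨i, rfl⟩ | rfl | rfl)
      · exact ⟨Fin.castAdd 2 i, Fin.append_left _ _ i⟩
      · exact ⟨Fin.natAdd k 0, Fin.append_right _ _ 0⟩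
      · exact ⟨Fin.natAdd k 1, Fin.append_right _ _ 1⟩
  rw [MapGerm.doublePointIdeal, hrange, Ideal.span_union, modelIdeal_eq]
  exact span_pair_sup_eq_of_sub_mem _ (dividedDifference_sub_pow_mem hh₁)
    (dividedDifference_sub_pow_mem hh₂)

theorem doublePointIdeal_of_pow {k a b : ℕ} {n : Fin k → ℕ}
    {f : MapGerm (Fin k ⊕ Fin 1) (Fin k ⊕ Fin (k + 2))}
    (hf : (fun i => f.comp (Sum.inr i)) = Matrix.vecCons (Conv.X (Sum.inr 0) ^ a)
      (Matrix.vecCons (Conv.X (Sum.inr 0) ^ b)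
        (fun i : Fin k => Conv.X (Sum.inl i) ^ n i * Conv.X (Sum.inr 0)))) :
    f.doublePointIdeal = modelIdeal a b n := by
  have hrange : Set.range (fun i => dividedDifference (f.comp (Sum.inr i))) =
      (Set.range fun i : Fin k => (Conv.X (Sum.inl i) : Conv (Fin k ⊕ Fin 2)) ^ n i) ∪
        {dividedDifference (Conv.X (Sum.inr 0) ^ a),
          dividedDifference (Conv.X (Sum.inr 0) ^ b)} := by
    have hcomp : (fun i => dividedDifference (f.comp (Sum.inr i))) =
        Matrix.vecCons (dividedDifference (Conv.X (Sum.inr 0) ^ a))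
          (Matrix.vecCons (dividedDifference (Conv.X (Sum.inr 0) ^ b))
            (fun i : Fin k => (Conv.X (Sum.inl i) : Conv (Fin k ⊕ Fin 2)) ^ n i)) := by
      funext i
      rw [congrFun hf i]
      refine Fin.cases rfl (fun i => Fin.cases rfl (fun i => ?_) i) i
      exact dividedDifference_X_pow_mul k (n i) i
    rw [hcomp, Matrix.range_cons, Matrix.range_cons, ← Set.union_assoc, Set.union_comm]
    rfl
  rw [MapGerm.doublePointIdeal, hrange, Ideal.span_union, modelIdeal_eq]

end JoinGerms

end

theorem mainTheorem10 (k m₁ m₂ : ℕ) (hm₁ : 1 < m₁) (hm₁₂ : m₁ < m₂) (hgcd : Nat.gcd m₁ m₂ = 1)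
    (φ₂ : JoinGerms.MapGerm (Fin 1) (Fin 2))
    (hφ₂ : φ₂.comp = ![JoinGerms.Conv.X 0 ^ m₁, JoinGerms.Conv.X 0 ^ m₂]) :
    Module.Finite ℂ (JoinGerms.Conv (Fin 1) ⧸ φ₂.pullback) ∧
    (∀ (h₁ h₂ : JoinGerms.Conv (Fin k ⊕ Fin 1)),
      JoinGerms.IsDeformationOfPower m₁ h₁ → JoinGerms.IsDeformationOfPower m₂ h₂ →
      ∀ f : JoinGerms.MapGerm (Fin k ⊕ Fin 1) (Fin k ⊕ Fin (k + 2)),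
        f.IsCorankOneForm →
        (fun i => f.comp (Sum.inr i)) = Fin.append
          (fun i : Fin k => JoinGerms.Conv.X (Sum.inl i) * JoinGerms.Conv.X (Sum.inr 0))
          ![h₁, h₂] →
        Module.Finite ℂ (JoinGerms.Conv (Fin k ⊕ Fin 2) ⧸ f.doublePointIdeal) ∧
        f.doublePointNumber = ((m₁ : ℚ) - 1) * ((m₂ : ℚ) - 1) / 2 ∧
        ((m₁ : ℚ) - 1) * ((m₂ : ℚ) - 1) / 2 = (φ₂.delta : ℚ)) ∧
    (∀ lam : Fin k → ℕ, (∀ i, 1 ≤ lam i) →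
      ∀ f : JoinGerms.MapGerm (Fin k ⊕ Fin 1) (Fin k ⊕ Fin (k + 2)),
        f.IsCorankOneForm →
        (fun i => f.comp (Sum.inr i)) = Matrix.vecCons (JoinGerms.Conv.X (Sum.inr 0) ^ m₁)
          (Matrix.vecCons (JoinGerms.Conv.X (Sum.inr 0) ^ m₂)
            (fun i : Fin k =>
              JoinGerms.Conv.X (Sum.inl i) ^ lam i * JoinGerms.Conv.X (Sum.inr 0))) →
        Module.Finite ℂ (JoinGerms.Conv (Fin k ⊕ Fin 2) ⧸ f.doublePointIdeal) ∧
        f.doublePointNumber = ((∏ i, lam i : ℕ) : ℚ) * (φ₂.delta : ℚ)) := by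
  have ha : 0 < m₁ := by omega
  have hb : 0 < m₂ := by omega
  obtain ⟨hδfin, hδ⟩ := JoinGerms.delta_monomialCurve hφ₂ ha hb hgcd
  have hδ' : ((m₁ : ℚ) - 1) * ((m₂ : ℚ) - 1) = 2 * (φ₂.delta : ℚ) := by
    have h : ((2 * φ₂.delta : ℕ) : ℚ) = (((m₁ - 1) * (m₂ - 1) : ℕ) : ℚ) := by rw [hδ]
    rw [Nat.cast_mul, Nat.cast_mul, Nat.cast_sub ha, Nat.cast_sub hb] at h
    push_cast at h
    exact h.symm
  refine ⟨hδfin, fun h₁ h₂ hh₁ hh₂ f _ hf => ?_, fun lam _ f _ hf => ?_⟩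
  · have hI := JoinGerms.doublePointIdeal_of_deformation hh₁ hh₂ hf
    obtain ⟨hfin, hrank⟩ :=
      JoinGerms.finrank_quotient_modelIdeal (fun _ : Fin k => 1) ha hgcd
    rw [JoinGerms.MapGerm.doublePointNumber, hI, hrank, ← hδ]
    refine ⟨hfin, ?_, ?_⟩
    · rw [hδ']
      simp
    · rw [hδ']
      ring
  · have hI := JoinGerms.doublePointIdeal_of_pow hf
    obtain ⟨hfin, hrank⟩ := JoinGerms.finrank_quotient_modelIdeal lam ha hgcd
    rw [JoinGerms.MapGerm.doublePointNumber, hI, hrank, ← hδ]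
    refine ⟨hfin, ?_⟩
    push_cast
    ring
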